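/- **Setting.** Let $\nu\in(0,1]$ (speed ratio), $R_0$ (outer radius of the target sensing region) and $0<r_A\le\min\{R_0-1,1\}$ (perception radius of the attacker), in units where the target is the unit disc and the defender's maximal speed is $1$. The state is $\mathbf s=(R,\theta)$, where $R$ is the distance of the attacker from the centre of the target and $\theta$ the angle from the defender, who moves on the unit circle, to the attacker. It evolves by $$\dot R=-\nu\cos\alpha,\qquad \dot\theta=\frac{\nu}{R}\sin\alpha-u,$$ where the controls $\alpha$ (attacker) and $u\in[-1,1]$ (defender) are measurable functions of time. The attacker *penetrates* (wins) if $R=1$ is reached with $\theta\not\equiv0\pmod{2\pi}$ at that time and before; the defender *intercepts* (wins) if $\theta\equiv0\pmod{2\pi}$ occurs no later than $R=1$. The play ends at penetration or interception. Opponents of the defender may use any $\alpha\in[-\pi,\pi]$; the attacker's own strategies below need only $\alpha\in(-\frac\pi2,\frac\pi2)$. Put $$g(R)=\sqrt{\tfrac{R^2}{\nu^2}-1}+\arcsin\tfrac{\nu}{R},\qquad \theta_G(R)=g(R)-g(1),\qquad \theta_p(R)=\arccos\frac{R^2+1-r_A^2}{2R},$$ $$\alpha^*(R,\theta)=\operatorname{sign}(\theta)\arcsin(\nu/R),\qquad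 u^*(R,\theta)=\operatorname{sign}(\theta).$$ **(1) Regions.** The state space $\{1<R\le R_0,\ |\theta|\le\pi\}$ is the disjoint union of $\mathcal R_D=\{|\theta|\le\theta_G(R)\}$ and $\mathcal R_A=\{|\theta|>\theta_G(R)\}$. From every state of $\mathcal R_D$ the feedback $u^*$ intercepts in finite time every attacker control. From every state of $\mathcal R_A$ the attacker has a nonanticipative strategy that penetrates in finite time against every defender control. **(2) Full-information Stage.** Let this stage occur, that is, let it start (or be considered) at a state $(R,\theta)$ with $1<R\le1+r_A$ and $|\theta|\le\theta_p(R)$; once begun, full information lasts until the play ends. (a) Let the attacker also be free to stop its attack at any time. Let its payoff be the terminal angular separation if it penetrates, $-\ell(R_f)$ if it is intercepted at distance $R_f$, and $0$ otherwise, where $\ell\ge0$ is any loss function on $[1,\infty)$ with $\ell(1)=0$. Then the attacker's rule "play $\alpha^*$ while $\theta_G(R)\le|\theta|$ and stop attacking as soon as $|\theta|<\theta_G(R)$", together with the defender's feedback $u^*$, is a saddle point, with value $\max\{|\theta|-\theta_G(R),0\}$: the rule secures at least this value against every defender control, and $u^*$ holds the attacker to at most this value against every heading control and every stopping time. (b)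 If the defender plays $u^*$ and the attacker uses any $\alpha\in(-\frac\pi2,\frac\pi2)$, then $R\le1+r_A$ and $|\theta|\le\theta_p(R)$ hold until the play ends. (c) If $\theta_G(R)\le|\theta|$ initially, the play under $\alpha^*$ and $u^*$ satisfies $\theta_G\le|\theta|\le\theta_p$ throughout and reaches $R=1$ in finite time, with terminal separation exactly $|\theta|-\theta_G(R)$ (initial values). (d) If $|\theta|\le\theta_G(R)$ initially, there is $\rho\in[1,R]$ with $\theta_G(\rho)=\theta_G(R)-|\theta|$ such that $u^*$ intercepts every attacker that does not stop, at a distance at least $\rho$ from the centre, while $\alpha^*$ (with $\theta$ followed continuously in time), played against any defender control, makes the play end in finite time at a distance at most $\rho$. -/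

import Mathlib

open Real Set MeasureTheory

noncomputable section

namespace CircularDefense

/-- A (nondimensional) state of the game: `R` is the distance of the attacker from the centre of the
unit circular target, `θ` is the polar angle of the attacker minus that of the defender.
(The third coordinate `β` of the dynamics, the polar angle of the defender, has `β' = u`
and enters neither the other two equations nor the terminal conditions.) -/
@[ext] structure State where
  R : ℝ
  θ : ℝ

/-! ### The surface, the perception angle and the regions -/

def g (ν R : ℝ) : ℝ := √(R ^ 2 / ν ^ 2 - 1) + arcsin (ν / R)

def thetaG (ν R : ℝ) : ℝ := g ν R - g ν 1

/-- The separation angle at which the defender is at distance `rA` from an attacker at radius `R`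
(meaningful for `1 ≤ R ≤ 1 + rA`). -/
def thetaP (rA R : ℝ) : ℝ := arccos ((R ^ 2 + 1 - rA ^ 2) / (2 * R))

/-- Attacker outside the target and inside the target sensing region of outer radius `R₀`. -/
def stateSpace (R₀ : ℝ) : Set State := {s | 1 < s.R ∧ s.R ≤ R₀ ∧ |s.θ| ≤ π}

def defenderRegion (ν R₀ : ℝ) : Set State := {s ∈ stateSpace R₀ | |s.θ| ≤ thetaG ν s.R}

def attackerRegion (ν R₀ : ℝ) : Set State := {s ∈ stateSpace R₀ | thetaG ν s.R < |s.θ|}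

/-- States in which the defender is within the perception radius `rA` of the attacker. -/
def fullInfoStage (rA : ℝ) : Set State :=
  {s | 1 < s.R ∧ s.R ≤ 1 + rA ∧ |s.θ| ≤ thetaP rA s.R}

/-! ### Dynamics: `R' = -ν cos α`, `θ' = (ν / R) sin α - u` -/

/-- Admissible heading controls of the attacker. -/
def AttackerControl (α : ℝ → ℝ) : Prop := Measurable α ∧ ∀ t, α t ∈ Icc (-π) π

/-- Admissible heading controls of an attacker that always approaches the target. -/
def ApproachControl (α : ℝ → ℝ) : Prop := Measurable α ∧ ∀ t, α t ∈ Ioo (-(π / 2)) (π / 2)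

/-- Admissible controls of the defender. -/
def DefenderControl (u : ℝ → ℝ) : Prop := Measurable u ∧ ∀ t, u t ∈ Icc (-1 : ℝ) 1

def radius (ν : ℝ) (s : State) (α : ℝ → ℝ) (t : ℝ) : ℝ :=
  s.R + ∫ x in (0 : ℝ)..t, -ν * cos (α x)

/-- The separation angle, followed continuously in time. -/
def angle (ν : ℝ) (s : State) (α u : ℝ → ℝ) (t : ℝ) : ℝ :=
  s.θ + ∫ x in (0 : ℝ)..t, (ν / radius ν s α x * sin (α x) - u x)

/-- The state at time `t` of the play from `s` with controls `α`, `u`. -/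
def stateAt (ν : ℝ) (s : State) (α u : ℝ → ℝ) (t : ℝ) : State :=
  ⟨radius ν s α t, angle ν s α u t⟩

/-! ### Termination -/

/-- The defender stands exactly on the ray from the centre to the attacker. -/
def State.Aligned (s : State) : Prop := (s.θ : Real.Angle) = 0

/-- The angular separation, in `[0, π]`. -/
def State.separation (s : State) : ℝ := |(s.θ : Real.Angle).toReal|

/-- The play has not ended before time `T`. -/
def RunningBefore (ν : ℝ) (s : State) (α u : ℝ → ℝ) (T : ℝ) : Prop :=
  ∀ t ∈ Ico 0 T, 1 < (stateAt ν s α u t).R ∧ ¬ (stateAt ν s α u t).Aligned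

/-- The attacker reaches the target at time `T`, the defender never having aligned with it:
the attacker wins. -/
def PenetratesAt (ν : ℝ) (s : State) (α u : ℝ → ℝ) (T : ℝ) : Prop :=
  0 ≤ T ∧ RunningBefore ν s α u T ∧
    (stateAt ν s α u T).R = 1 ∧ ¬ (stateAt ν s α u T).Aligned

/-- The defender aligns with the attacker at time `T`, the attacker not having reached the target
earlier: the defender wins. -/
def InterceptsAt (ν : ℝ) (s : State) (α u : ℝ → ℝ) (T : ℝ) : Prop :=
  0 ≤ T ∧ RunningBefore ν s α u T ∧
    1 ≤ (stateAt ν s α u T).R ∧ (stateAt ν s α u T).Aligned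

/-! ### Feedback strategies -/

def alphaStar (ν : ℝ) (s : State) : ℝ := Real.sign s.θ * arcsin (ν / s.R)

def uStar (s : State) : ℝ := Real.sign s.θ

/-- The attacker's rule in the full-information stage: `some a` means "attack with heading `a`",
`none` means "stop attacking". -/
def attackerStrategy (ν : ℝ) (s : State) : Option ℝ :=
  open Classical in if thetaG ν s.R ≤ |s.θ| then some (alphaStar ν s) else none

/-- The defender plays `u*` as long as the play lasts. -/
def DefenderFollows (ν : ℝ) (s : State) (α u : ℝ → ℝ) : Prop :=
  ∀ᵐ t : ℝ, 0 ≤ t → RunningBefore ν s α u t → u t = uStar (stateAt ν s α u t)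

/-- The attacker plays `α*` as long as the play lasts, without ever stopping its attack. -/
def AttackerSteers (ν : ℝ) (s : State) (α u : ℝ → ℝ) : Prop :=
  ∀ᵐ t : ℝ, 0 ≤ t → RunningBefore ν s α u t → α t = alphaStar ν (stateAt ν s α u t)

/-- The attacker, with heading control `α` and stopping time `τ` (`⊤` if it never stops), follows
`attackerStrategy`: up to `τ` it uses the prescribed heading, and it stops exactly
when it is told to. -/
def AttackerFollows (ν : ℝ) (s : State) (α : ℝ → ℝ) (τ : EReal) (u : ℝ → ℝ) : Prop :=
  (∀ᵐ t : ℝ, 0 ≤ t → (t : EReal) < τ → RunningBefore ν s α u t →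
      attackerStrategy ν (stateAt ν s α u t) = some (α t)) ∧
  ∀ t : ℝ, 0 ≤ t → (t : EReal) ≤ τ → RunningBefore ν s α u t →
      (τ = (t : EReal) ↔ attackerStrategy ν (stateAt ν s α u t) = none)

/-! ### Winning -/

/-- Playing `u*` from `s`, the defender wins in finite time against every attacker control. -/
def DefenderWins (ν : ℝ) (s : State) : Prop :=
  ∀ α, AttackerControl α →
    (∃ u, DefenderControl u ∧ DefenderFollows ν s α u) ∧
    ∀ u, DefenderControl u → DefenderFollows ν s α u → ∃ T, InterceptsAt ν s α u T

/-- A map from defender controls to attacker controls that does not look into the future. -/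
def Nonanticipative (A : (ℝ → ℝ) → ℝ → ℝ) : Prop :=
  ∀ u v, DefenderControl u → DefenderControl v → ∀ t : ℝ,
    (∀ᵐ x : ℝ, x ∈ Icc 0 t → u x = v x) → ∀ᵐ x : ℝ, x ∈ Icc 0 t → A u x = A v x

/-- From `s` the attacker has a strategy, not looking into the future, that wins
against every defender control. -/
def AttackerWins (ν : ℝ) (s : State) : Prop :=
  ∃ A : (ℝ → ℝ) → ℝ → ℝ, Nonanticipative A ∧
    ∀ u, DefenderControl u → ApproachControl (A u) ∧ ∃ T, PenetratesAt ν s (A u) u T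

/-! ### The game in which the attacker may also stop its attack -/

inductive Outcome where
  | penetration (separation : ℝ)
  | interception (distance : ℝ)
  | withdrawal
  | undecided

/-- The outcome of the play in which the attacker uses the heading control `α` and stops
its attack at time `τ`. -/
def HasOutcome (ν : ℝ) (s : State) (α : ℝ → ℝ) (τ : EReal) (u : ℝ → ℝ) : Outcome → Prop
  | .penetration d => ∃ T : ℝ, (T : EReal) < τ ∧ PenetratesAt ν s α u T ∧
      (stateAt ν s α u T).separation = d
  | .interception r => ∃ T : ℝ, (T : EReal) < τ ∧ InterceptsAt ν s α u T ∧
      (stateAt ν s α u T).R = r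
  | .withdrawal => ∃ T : ℝ, 0 ≤ T ∧ τ = (T : EReal) ∧ RunningBefore ν s α u T
  | .undecided => τ = ⊤ ∧ ∀ T : ℝ, RunningBefore ν s α u T

/-- Payoff to the attacker: the terminal separation if it penetrates, minus the loss `ℓ r` if it is
intercepted at distance `r` from the centre, and zero otherwise. -/
def payoff (ℓ : ℝ → ℝ) : Outcome → ℝ
  | .penetration d => d
  | .interception r => -ℓ r
  | .withdrawal => 0
  | .undecided => 0

/-- Against every defender control, `attackerStrategy` can be played and
yields the attacker at least `w`. -/
def AttackerSecures (ν : ℝ) (ℓ : ℝ → ℝ) (s : State) (w : ℝ) : Prop :=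
  ∀ u, DefenderControl u →
    (∃ α τ, ApproachControl α ∧ 0 ≤ τ ∧ AttackerFollows ν s α τ u) ∧
    ∀ α τ, AttackerControl α → 0 ≤ τ → AttackerFollows ν s α τ u →
      ∃ o, HasOutcome ν s α τ u o ∧ w ≤ payoff ℓ o

/-- Against every heading control and stopping time of the attacker, `u*` can be played and
yields the attacker at most `w`. -/
def DefenderSecures (ν : ℝ) (ℓ : ℝ → ℝ) (s : State) (w : ℝ) : Prop :=
  ∀ α τ, AttackerControl α → 0 ≤ τ →
    (∃ u, DefenderControl u ∧ DefenderFollows ν s α u) ∧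
    ∀ u, DefenderControl u → DefenderFollows ν s α u →
      ∃ o, HasOutcome ν s α τ u o ∧ payoff ℓ o ≤ w

end CircularDefense

end

open CircularDefense

namespace CircularDefense

/-! Everything rests on one potential, the excess `σ * θ - thetaG ν R`, where `σ = ±1` is the
initial sign of `θ`. With `q = tangentLength ν R` the slope of the surface is `q / (ν R)`. If the
defender plays `u = σ`, the excess changes at the rate `σ (ν / R) sin α + (q / R) cos α - 1`. This
is at most zero, because `(ν / R, q / R)` and `(sin α, cos α)` are unit vectors, and it vanishes
exactly for the heading `α*` (`approach_rate_le`). So `u*` keeps the excess from growing against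
every heading, `α*` keeps it from shrinking against every `u`, and together they hold it constant.
As `thetaG` vanishes at the target, the excess is there the separation: hence the two regions, the
value of the game and the terminal distance level.

On the attacker's side the computation is explicit. Under `α*` the attacker runs along a tangent to
the circle of radius `ν`, so `q` decreases at rate `ν`, and the surface drops by the elapsed time
minus the swept angle (`thetaG_sub_thetaG_tangentRadius`). The swept angle stays below `π / 2`,
which limits what a defender gains by running the long way round (`tangent_bounds`). In the
full-information stage `|θ| ≤ π / 2`, so the attacker may keep one side throughout. From a general
state above the surface it may not; there it chooses the nearer side anew at sampling times.
Sampling costs a fixed part of the initial margin, without accumulation (`le_separation_sampled`).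

On the defender's side it remains to prove that interception takes finite time
(`DefenderFollows.exists_not_running`). For `ν < 1` the separation shrinks at rate at least `1 - ν`.
For `ν = 1` the rate `1 - 1 / R` may tend to zero near the target, but lying below the surface
bounds it from below by a multiple of `θ ^ (2 / 3)`, which still forces extinction in finite time.

Controls are only measurable, so monotonicity is obtained from integral identities along Lipschitz
trajectories. While play lasts the sign of `θ` is constant, so both feedbacks can be realized with a
constant side. -/

/-! ### Calculus of the surface -/

/-- Length of the tangent segments from a point at distance `R` from the centre to the circle of
radius `ν`. -/
noncomputable def tangentLength (ν R : ℝ) : ℝ := √(R ^ 2 - ν ^ 2)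

lemma tangentLength_nonneg (ν R : ℝ) : 0 ≤ tangentLength ν R := sqrt_nonneg _

lemma continuous_tangentLength (ν : ℝ) : Continuous (tangentLength ν) := by
  unfold tangentLength; fun_prop

lemma tangentLength_sq {ν R : ℝ} (hν : 0 < ν) (h : ν ≤ R) :
    tangentLength ν R ^ 2 = R ^ 2 - ν ^ 2 :=
  sq_sqrt (by nlinarith)

lemma tangentLength_pos {ν R : ℝ} (hν : 0 < ν) (h : ν < R) : 0 < tangentLength ν R :=
  sqrt_pos.2 (by nlinarith)

lemma tangentLength_mono {ν R S : ℝ} (hR : 0 ≤ R) (h : R ≤ S) :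
    tangentLength ν R ≤ tangentLength ν S :=
  sqrt_le_sqrt (by nlinarith)

lemma tangentLength_strictMono {ν R S : ℝ} (hν : 0 < ν) (hR : ν ≤ R) (h : R < S) :
    tangentLength ν R < tangentLength ν S :=
  sqrt_lt_sqrt (by nlinarith) (by nlinarith)

lemma cos_arcsin_div {ν R : ℝ} (hR : 0 < R) :
    cos (arcsin (ν / R)) = tangentLength ν R / R := by
  rw [cos_arcsin, tangentLength, div_pow, one_sub_div (by positivity), sqrt_div' _ (by positivity),
    sqrt_sq hR.le]

lemma sin_arcsin_div {ν R : ℝ} (hν : 0 < ν) (h : ν ≤ R) : sin (arcsin (ν / R)) = ν / R := by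
  have hR := hν.trans_le h
  exact sin_arcsin (by have : 0 < ν / R := by positivity
                       linarith) ((div_le_one hR).2 h)

/-- In the variable `x = tangentLength ν R / ν` the surface is `x - arctan x` up to a constant, the
involute of the circle of radius `ν`. This is the variable that is affine in time on a tangential
attack. -/
lemma g_eq {ν R : ℝ} (hν : 0 < ν) (h : ν ≤ R) :
    g ν R = tangentLength ν R / ν + (π / 2 - arctan (tangentLength ν R / ν)) := by
  have hR := hν.trans_le h
  have h1 : √(R ^ 2 / ν ^ 2 - 1) = tangentLength ν R / ν := by
    rw [tangentLength, div_sub_one (by positivity), sqrt_div' _ (by positivity), sqrt_sq hν.le]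
  have h2 : arcsin (ν / R) = π / 2 - arctan (tangentLength ν R / ν) := by
    rw [arcsin_eq_pi_div_two_sub_arccos, arccos_eq_arctan (by positivity), ← cos_arcsin,
      cos_arcsin_div hR]
    congr 2
    field_simp
  rw [g, h1, h2]

lemma thetaG_eq {ν R : ℝ} (hν : 0 < ν) (hν1 : ν ≤ 1) (h : 1 ≤ R) :
    thetaG ν R = (tangentLength ν R / ν - arctan (tangentLength ν R / ν))
      - (tangentLength ν 1 / ν - arctan (tangentLength ν 1 / ν)) := by
  rw [thetaG, g_eq hν (hν1.trans h), g_eq hν hν1]; ring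

@[simp] lemma thetaG_one (ν : ℝ) : thetaG ν 1 = 0 := by simp [thetaG]

lemma continuousOn_thetaG {ν : ℝ} (hν : 0 < ν) (hν1 : ν ≤ 1) :
    ContinuousOn (thetaG ν) (Ici 1) := by
  refine ContinuousOn.congr (f := fun R => (tangentLength ν R / ν - arctan (tangentLength ν R / ν))
      - (tangentLength ν 1 / ν - arctan (tangentLength ν 1 / ν))) ?_
    fun R hR => thetaG_eq hν hν1 hR
  have := continuous_tangentLength ν
  fun_prop

lemma hasDerivAt_thetaG {ν R : ℝ} (hν : 0 < ν) (hν1 : ν ≤ 1) (h : 1 < R) :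
    HasDerivAt (thetaG ν) (tangentLength ν R / (ν * R)) R := by
  have hq := tangentLength_pos hν (hν1.trans_lt h)
  have hqs := tangentLength_sq hν (hν1.trans h.le)
  have h1 : HasDerivAt (tangentLength ν) (R / tangentLength ν R) R := by
    have := (((hasDerivAt_id R).pow 2).sub_const (ν ^ 2)).sqrt (by
      simp only [Pi.pow_apply, id]; nlinarith)
    refine this.congr_deriv ?_
    simp only [Pi.pow_apply, id, tangentLength]
    field_simp
    norm_num
  have h2 := (((h1.div_const ν).sub (h1.div_const ν).arctan).sub_const
    (tangentLength ν 1 / ν - arctan (tangentLength ν 1 / ν)))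
  refine (h2.congr_deriv ?_).congr_of_eventuallyEq ?_
  · have hR : 0 < R := by linarith
    have : 1 + (tangentLength ν R / ν) ^ 2 = R ^ 2 / ν ^ 2 := by
      rw [div_pow, hqs]; field_simp; ring
    rw [this]
    field_simp
    rw [← hqs]
  · filter_upwards [lt_mem_nhds h] with x hx
    exact thetaG_eq hν hν1 hx.le

lemma strictMonoOn_thetaG {ν : ℝ} (hν : 0 < ν) (hν1 : ν ≤ 1) :
    StrictMonoOn (thetaG ν) (Ici 1) := by
  refine strictMonoOn_of_deriv_pos (convex_Ici 1) (continuousOn_thetaG hν hν1) fun x hx => ?_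
  rw [interior_Ici, mem_Ioi] at hx
  rw [(hasDerivAt_thetaG hν hν1 hx).deriv]
  have := tangentLength_pos hν (hν1.trans_lt hx)
  positivity

lemma thetaG_nonneg {ν R : ℝ} (hν : 0 < ν) (hν1 : ν ≤ 1) (h : 1 ≤ R) : 0 ≤ thetaG ν R := by
  rw [← thetaG_one ν]
  exact (strictMonoOn_thetaG hν hν1).monotoneOn self_mem_Ici h h

lemma thetaG_pos {ν R : ℝ} (hν : 0 < ν) (hν1 : ν ≤ 1) (h : 1 < R) : 0 < thetaG ν R := by
  rw [← thetaG_one ν]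
  exact strictMonoOn_thetaG hν hν1 self_mem_Ici h.le h

/-- A continuous extension of the derivative of `thetaG ν` from `[1, ∞)` to the real line. -/
noncomputable def surfaceSlope (ν x : ℝ) : ℝ := tangentLength ν (max x 1) / (ν * max x 1)

lemma continuous_surfaceSlope {ν : ℝ} (hν : 0 < ν) : Continuous (surfaceSlope ν) := by
  have h := continuous_tangentLength ν
  have : ∀ x : ℝ, ν * max x 1 ≠ 0 := fun x => by positivity
  unfold surfaceSlope
  fun_prop (disch := assumption)

lemma abs_surfaceSlope_le {ν : ℝ} (hν : 0 < ν) (x : ℝ) : |surfaceSlope ν x| ≤ 1 / ν := by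
  have h0 : 0 < max x 1 := by positivity
  have h := tangentLength_nonneg ν (max x 1)
  rw [surfaceSlope, abs_of_nonneg (by positivity), div_le_div_iff₀ (by positivity) hν]
  have : tangentLength ν (max x 1) ≤ max x 1 := by
    rw [tangentLength]
    exact (sqrt_le_left h0.le).2 (by nlinarith)
  nlinarith

/-- A continuously differentiable extension of `thetaG ν` from `[1, ∞)` to the real line. -/
noncomputable def surfaceExt (ν x : ℝ) : ℝ := ∫ y in (1 : ℝ)..x, surfaceSlope ν y

lemma hasDerivAt_surfaceExt {ν : ℝ} (hν : 0 < ν) (x : ℝ) :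
    HasDerivAt (surfaceExt ν) (surfaceSlope ν x) x :=
  ((continuous_surfaceSlope hν).integral_hasStrictDerivAt 1 x).hasDerivAt

lemma surfaceExt_eq {ν x : ℝ} (hν : 0 < ν) (hν1 : ν ≤ 1) (hx : 1 ≤ x) :
    surfaceExt ν x = thetaG ν x := by
  rw [surfaceExt, intervalIntegral.integral_eq_sub_of_hasDerivAt_of_le hx
    ((continuousOn_thetaG hν hν1).mono Icc_subset_Ici_self) _
    ((continuous_surfaceSlope hν).intervalIntegrable _ _), thetaG_one, sub_zero]
  intro y hy
  rw [surfaceSlope, max_eq_left hy.1.le]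
  exact hasDerivAt_thetaG hν hν1 hy.1

/-- A global Lipschitz bound makes the composition with a merely Lipschitz radius absolutely
continuous, hence the integral of its derivative. -/
lemma lipschitzWith_surfaceExt {ν : ℝ} (hν : 0 < ν) :
    LipschitzWith (1 / ν).toNNReal (surfaceExt ν) := by
  refine lipschitzWith_of_nnnorm_deriv_le (fun x => (hasDerivAt_surfaceExt hν x).differentiableAt)
    fun x => ?_
  rw [(hasDerivAt_surfaceExt hν x).deriv, ← NNReal.coe_le_coe, coe_nnnorm, norm_eq_abs,
    Real.coe_toNNReal _ (by positivity)]
  exact abs_surfaceSlope_le hν x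

/-- With equal speeds the surface is flat enough at the target for interception in finite time. -/
lemma sq_le_of_le_thetaG_one {y R : ℝ} (hR : 1 ≤ R) (hy : 0 ≤ y) (hyπ : y ≤ π)
    (h : y ≤ thetaG 1 R) : y ^ 2 ≤ 216 * (1 - 1 / R) ^ 3 := by
  have hR0 : 0 < R := by linarith
  rcases le_total R 2 with h2 | h2
  -- Used at `ξ ≥ 0` to give `ξ - arctan ξ ≤ ξ ^ 3`. Hence `y ^ 2 ≤ (R ^ 2 - 1) ^ 3`, and `R ^ 2 - 1
  -- = R (R + 1) (1 - 1 / R)` with `R (R + 1) ≤ 6` yields `216 = 6 ^ 3`.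
  · have hmono : Monotone fun x : ℝ => x ^ 3 - x + arctan x := by
      have hd : ∀ x : ℝ, HasDerivAt (fun x : ℝ => x ^ 3 - x + arctan x)
          (3 * x ^ 2 - 1 + 1 / (1 + x ^ 2)) x := fun x =>
        (((hasDerivAt_pow 3 x).sub (hasDerivAt_id' x)).add (hasDerivAt_arctan x)).congr_deriv
          (by norm_num)
      refine monotone_of_deriv_nonneg (fun x => (hd x).differentiableAt) fun x => ?_
      rw [(hd x).deriv]
      have : 3 * x ^ 2 - 1 + 1 / (1 + x ^ 2) = (2 * x ^ 2 + 3 * x ^ 4) / (1 + x ^ 2) := by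
        field_simp; ring
      rw [this]; positivity
    set ξ := tangentLength 1 R with hξ
    have hξ0 : 0 ≤ ξ := tangentLength_nonneg 1 R
    have h1 : ξ - arctan ξ ≤ ξ ^ 3 := by
      have := hmono hξ0
      simp at this
      linarith
    have hone : tangentLength 1 1 = 0 := by simp [tangentLength]
    rw [thetaG_eq one_pos le_rfl hR, hone] at h
    simp only [div_one, arctan_zero, sub_zero] at h
    have h3 : y ^ 2 ≤ (ξ ^ 2) ^ 3 := by
      calc y ^ 2 ≤ (ξ ^ 3) ^ 2 := by gcongr; linarith
        _ = _ := by ring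
    rw [hξ, tangentLength_sq one_pos hR] at h3
    have hw : 0 ≤ 1 - 1 / R := by
      rw [sub_nonneg, div_le_one hR0]; exact hR
    have h4 : R ^ 2 - 1 ^ 2 ≤ 6 * (1 - 1 / R) := by
      have : R ^ 2 - 1 ^ 2 = R * (R + 1) * (1 - 1 / R) := by field_simp; ring
      rw [this]
      gcongr
      nlinarith
    calc y ^ 2 ≤ (R ^ 2 - 1 ^ 2) ^ 3 := h3
      _ ≤ (6 * (1 - 1 / R)) ^ 3 := by
          gcongr
          nlinarith
      _ = _ := by ring
  -- Far from the target the right-hand side is at least `27`, more than `π ^ 2`.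
  · have hw : 1 / 2 ≤ 1 - 1 / R := by
      have : 1 / R ≤ 1 / 2 := one_div_le_one_div_of_le (by norm_num) h2
      linarith
    have h3 : (1 / 2 : ℝ) ^ 3 ≤ (1 - 1 / R) ^ 3 := by gcongr
    have := pi_lt_four
    nlinarith

/-! ### The perception angle -/

/-- After cross-multiplication the difference is `(S - R) (R S - 1 + rA ^ 2)`. Together with `|θ|`
not increasing under `u*`, this keeps an approaching attacker inside the stage. -/
lemma thetaP_antitone {rA R S : ℝ} (hR : 1 ≤ R) (h : R ≤ S) : thetaP rA S ≤ thetaP rA R := by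
  refine arccos_le_arccos ?_
  rw [div_le_div_iff₀ (by linarith) (by linarith)]
  have h1 : 0 ≤ (S - R) * (R * S - 1) :=
    mul_nonneg (by linarith) (by nlinarith)
  have h2 : 0 ≤ (S - R) * rA ^ 2 := mul_nonneg (by linarith) (sq_nonneg _)
  nlinarith

/-- The bound `π / 2` is what allows the attacker to keep one side during the whole stage. -/
lemma thetaP_lt {rA R : ℝ} (hr : 0 < rA) (hr1 : rA ≤ 1) (hR : 1 ≤ R) : thetaP rA R < π / 2 := by
  rw [thetaP, arccos_lt_pi_div_two]
  have : 0 < R ^ 2 + 1 - rA ^ 2 := by nlinarith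
  positivity

end CircularDefense

namespace CircularDefense

/-! ### Trajectories -/

lemma intervalIntegrable_of_abs_le {f : ℝ → ℝ} {C : ℝ} (hf : Measurable f) (h : ∀ x, |f x| ≤ C)
    (a b : ℝ) : IntervalIntegrable f volume a b :=
  (intervalIntegrable_const (c := C)).mono_fun hf.aestronglyMeasurable
    (Filter.Eventually.of_forall fun x => by
      simpa [Real.norm_eq_abs] using (h x).trans (le_abs_self C))

lemma DefenderControl.abs_le {u : ℝ → ℝ} (h : DefenderControl u) (t : ℝ) : |u t| ≤ 1 :=
  _root_.abs_le.2 (h.2 t)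

lemma DefenderControl.intervalIntegrable {u : ℝ → ℝ} (h : DefenderControl u) (a b : ℝ) :
    IntervalIntegrable u volume a b :=
  intervalIntegrable_of_abs_le h.1 h.abs_le a b

variable {ν : ℝ} {s : State} {α u : ℝ → ℝ}

lemma measurable_radiusRate (hα : Measurable α) : Measurable fun x => -ν * cos (α x) :=
  (measurable_cos.comp hα).const_mul _

lemma abs_radiusRate_le (ν : ℝ) (α : ℝ → ℝ) (x : ℝ) : |-ν * cos (α x)| ≤ |ν| := by
  rw [abs_mul, abs_neg]
  exact mul_le_of_le_one_right (abs_nonneg _) (abs_cos_le_one _)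

lemma intervalIntegrable_radiusRate (hα : Measurable α) (a b : ℝ) :
    IntervalIntegrable (fun x => -ν * cos (α x)) volume a b :=
  intervalIntegrable_of_abs_le (measurable_radiusRate hα) (abs_radiusRate_le ν α) a b

@[simp] lemma radius_zero (ν : ℝ) (s : State) (α : ℝ → ℝ) : radius ν s α 0 = s.R := by
  simp [radius]

@[simp] lemma angle_zero (ν : ℝ) (s : State) (α u : ℝ → ℝ) : angle ν s α u 0 = s.θ := by
  simp [angle]

lemma continuous_radius (hα : Measurable α) : Continuous (radius ν s α) :=
  (intervalIntegral.continuous_primitive (intervalIntegrable_radiusRate hα) 0).const_add _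

/-- The rate of change of the separation angle, regularized inside the target. -/
noncomputable def angleRate (ν : ℝ) (s : State) (α u : ℝ → ℝ) (x : ℝ) : ℝ :=
  ν / max (radius ν s α x) 1 * sin (α x) - u x

/-- The separation angle, regularized inside the target. -/
noncomputable def angleReg (ν : ℝ) (s : State) (α u : ℝ → ℝ) (t : ℝ) : ℝ :=
  s.θ + ∫ x in (0 : ℝ)..t, angleRate ν s α u x

lemma measurable_angleRate (hα : Measurable α) (hu : Measurable u) :
    Measurable (angleRate ν s α u) :=
  ((measurable_const.div ((continuous_radius hα).measurable.max measurable_const)).mul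
    (measurable_sin.comp hα)).sub hu

lemma abs_div_max_mul_sin_le (ν r a : ℝ) : |ν / max r 1 * sin a| ≤ |ν| := by
  have h1 : 1 ≤ max r 1 := le_max_right _ _
  rw [abs_mul, abs_div, abs_of_pos (by linarith : 0 < max r 1)]
  calc |ν| / max r 1 * |sin a| ≤ |ν| / max r 1 * 1 := by gcongr; exact abs_sin_le_one _
    _ ≤ |ν| := by rw [mul_one]; exact div_le_self (abs_nonneg _) h1

lemma intervalIntegrable_angleRate (hα : Measurable α) (hu : DefenderControl u) (a b : ℝ) :
    IntervalIntegrable (angleRate ν s α u) volume a b := by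
  refine intervalIntegrable_of_abs_le (C := |ν| + 1) (measurable_angleRate hα hu.1) (fun x => ?_) a b
  exact (abs_sub _ _).trans (add_le_add (abs_div_max_mul_sin_le _ _ _) (hu.abs_le x))

lemma continuous_angleReg (hα : Measurable α) (hu : DefenderControl u) :
    Continuous (angleReg ν s α u) :=
  (intervalIntegral.continuous_primitive (intervalIntegrable_angleRate hα hu) 0).const_add _

lemma angle_eq_angleReg {t : ℝ} (ht : 0 ≤ t) (h : ∀ x ∈ Icc 0 t, 1 ≤ radius ν s α x) :
    angle ν s α u t = angleReg ν s α u t := by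
  unfold angle angleReg
  congr 1
  refine intervalIntegral.integral_congr fun x hx => ?_
  rw [uIcc_of_le ht] at hx
  simp only [angleRate, max_eq_left (h x hx)]

lemma RunningBefore.mono {T S : ℝ} (h : RunningBefore ν s α u T) (hST : S ≤ T) :
    RunningBefore ν s α u S :=
  fun t ht => h t ⟨ht.1, ht.2.trans_le hST⟩

lemma forall_Icc_of_forall_Ico {p : ℝ → Prop} (hp : IsClosed {x | p x}) {T : ℝ} (h0 : p 0)
    (h : ∀ t ∈ Ico 0 T, p t) : ∀ t ∈ Icc 0 T, p t := by
  rcases eq_or_ne T 0 with rfl | hT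
  · intro t ht
    rwa [← le_antisymm ht.1 ht.2]
  · rw [← closure_Ico hT.symm]
    exact closure_minimal h hp

lemma RunningBefore.one_le_radius {T : ℝ} (h : RunningBefore ν s α u T) (hα : Measurable α)
    (hs : 1 < s.R) : ∀ t ∈ Icc 0 T, 1 ≤ radius ν s α t :=
  forall_Icc_of_forall_Ico (isClosed_le continuous_const (continuous_radius hα))
    (by simpa using hs.le) fun t ht => (h t ht).1.le

lemma RunningBefore.angle_eq {T : ℝ} (h : RunningBefore ν s α u T) (hα : Measurable α)
    (hs : 1 < s.R) : ∀ t ∈ Icc 0 T, angle ν s α u t = angleReg ν s α u t := fun _ ht =>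
  angle_eq_angleReg ht.1 fun x hx => h.one_le_radius hα hs x ⟨hx.1, hx.2.trans ht.2⟩

lemma isClosed_coe_angle_eq_zero {f : ℝ → ℝ} (hf : Continuous f) :
    IsClosed {t | (f t : Real.Angle) = 0} :=
  isClosed_singleton.preimage (Real.Angle.continuous_coe.comp hf)

/-- Either the play lasts forever or it ends at a first time. -/
lemma running_or_ends (hα : Measurable α) (hu : DefenderControl u) (hs : 1 < s.R) :
    (∀ T, RunningBefore ν s α u T) ∨ ∃ T, 0 ≤ T ∧ RunningBefore ν s α u T ∧
      1 ≤ radius ν s α T ∧ (radius ν s α T = 1 ∨ (stateAt ν s α u T).Aligned) := by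
  -- The terminal times form a closed set once the angle is replaced by its continuous
  -- regularization, so the infimum is attained. Up to that time the two angles agree.
  set C : Set ℝ := Ici 0 ∩ ({t | radius ν s α t ≤ 1} ∪ {t | (angleReg ν s α u t : Real.Angle) = 0})
    with hC
  have hCc : IsClosed C := isClosed_Ici.inter
    ((isClosed_le (continuous_radius hα) continuous_const).union
      (isClosed_coe_angle_eq_zero (continuous_angleReg hα hu)))
  have key : ∀ T, (∀ t ∈ Ico 0 T, t ∉ C) → RunningBefore ν s α u T := by
    intro T hT t ht
    have hR : ∀ x ∈ Ico 0 T, 1 < radius ν s α x := fun x hx => by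
      by_contra! h
      exact hT x hx ⟨hx.1, Or.inl h⟩
    refine ⟨hR t ht, fun hal => hT t ht ⟨ht.1, Or.inr ?_⟩⟩
    have := angle_eq_angleReg (u := u) ht.1 fun x hx => (hR x ⟨hx.1, hx.2.trans_lt ht.2⟩).le
    rwa [Set.mem_ofPred_eq, ← this]
  rcases C.eq_empty_or_nonempty with hE | hne
  · exact Or.inl fun T => key T fun t _ => by simp [hE]
  · right
    have hbdd : BddBelow C := ⟨0, fun t ht => ht.1⟩
    have hmem := hCc.csInf_mem hne hbdd
    have hrun := key (sInf C) fun t ht h => absurd (csInf_le hbdd h) (not_le.2 ht.2)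
    have hT : sInf C ∈ Icc 0 (sInf C) := ⟨hmem.1, le_rfl⟩
    have h1 := hrun.one_le_radius hα hs _ hT
    refine ⟨sInf C, hmem.1, hrun, h1, ?_⟩
    rcases hmem.2 with h | h
    · exact Or.inl (le_antisymm h h1)
    · right
      show (angle ν s α u (sInf C) : Real.Angle) = 0
      rwa [hrun.angle_eq hα hs _ hT]

/-! ### The side on which the attacker is seen -/

lemma abs_mul_sign {σ : ℝ} (hσ : σ = 1 ∨ σ = -1) (x : ℝ) : |σ * x| = |x| := by
  rcases hσ with rfl | rfl <;> simp

lemma coe_eq_zero_of_mul {σ x : ℝ} (hσ : σ = 1 ∨ σ = -1) :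
    ((σ * x : ℝ) : Real.Angle) = 0 ↔ (x : Real.Angle) = 0 := by
  rcases hσ with rfl | rfl <;> simp

lemma coe_ne_zero_of_mem_Ioo {x : ℝ} (h : x ∈ Ioo 0 (2 * π)) : (x : Real.Angle) ≠ 0 := by
  rw [Ne, Real.Angle.coe_eq_zero_iff]
  rintro ⟨n, rfl⟩
  have hp := two_pi_pos
  rw [zsmul_eq_mul] at h
  have h1 : (0 : ℝ) < n := by
    by_contra! hn
    nlinarith [h.1]
  have h2 : (n : ℝ) < 1 := by
    by_contra! hn
    nlinarith [h.2]
  have h3 : 0 < n := by exact_mod_cast h1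
  have h4 : n < 1 := by exact_mod_cast h2
  omega

lemma eq_zero_or_of_coe_eq_zero {x : ℝ} (h : x ∈ Icc 0 (2 * π)) (hx : (x : Real.Angle) = 0) :
    x = 0 ∨ x = 2 * π := by
  by_contra! hne
  exact coe_ne_zero_of_mem_Ioo ⟨lt_of_le_of_ne h.1 hne.1.symm, lt_of_le_of_ne h.2 hne.2⟩ hx

lemma sign_eq_of_mul_pos {σ x : ℝ} (hσ : σ = 1 ∨ σ = -1) (h : 0 < σ * x) : Real.sign x = σ := by
  rcases hσ with rfl | rfl
  · exact Real.sign_of_pos (by linarith)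
  · exact Real.sign_of_neg (by linarith)

/-- By continuity, leaving the interval means passing through `0` or `2 * π`, and both are
alignments. -/
lemma RunningBefore.mul_angle_mem_Ioo {T σ : ℝ} (h : RunningBefore ν s α u T) (hα : Measurable α)
    (hu : DefenderControl u) (hs : 1 < s.R) (hσ : σ = 1 ∨ σ = -1)
    (h0 : σ * s.θ ∈ Ioo 0 (2 * π)) : ∀ t ∈ Ico 0 T, σ * angle ν s α u t ∈ Ioo 0 (2 * π) := by
  intro t ht
  set f := fun x => σ * angleReg ν s α u x with hf
  have hfc : Continuous f := (continuous_angleReg hα hu).const_mul σ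
  have hne : ∀ x ∈ Icc 0 t, (f x : Real.Angle) ≠ 0 := fun x hx => by
    have hx' : x ∈ Ico 0 T := ⟨hx.1, hx.2.trans_lt ht.2⟩
    rw [hf, Ne, coe_eq_zero_of_mul hσ, ← h.angle_eq hα hs x ⟨hx'.1, hx'.2.le⟩]
    exact (h x hx').2
  have hf0 : f 0 = σ * s.θ := by simp [hf, angleReg]
  rw [h.angle_eq hα hs t ⟨ht.1, ht.2.le⟩]
  constructor
  · by_contra! hneg
    obtain ⟨x, hx, hx0⟩ := intermediate_value_Icc' ht.1 hfc.continuousOn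
      (show (0 : ℝ) ∈ Icc (f t) (f 0) from ⟨hneg, hf0 ▸ h0.1.le⟩)
    exact hne x hx (by simp [hx0])
  · by_contra! hbig
    obtain ⟨x, hx, hx0⟩ := intermediate_value_Icc ht.1 hfc.continuousOn
      (show 2 * π ∈ Icc (f 0) (f t) from ⟨hf0 ▸ h0.2.le, hbig⟩)
    exact hne x hx (by rw [hx0, Real.Angle.coe_two_pi])

lemma RunningBefore.mul_angle_mem_Icc {T σ : ℝ} (h : RunningBefore ν s α u T) (hα : Measurable α)
    (hu : DefenderControl u) (hs : 1 < s.R) (hσ : σ = 1 ∨ σ = -1)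
    (h0 : σ * s.θ ∈ Ioo 0 (2 * π)) : ∀ t ∈ Icc 0 T, σ * angle ν s α u t ∈ Icc 0 (2 * π) := by
  intro t ht
  rw [h.angle_eq hα hs t ht]
  refine forall_Icc_of_forall_Ico (p := fun t => σ * angleReg ν s α u t ∈ Icc 0 (2 * π))
    (isClosed_Icc.preimage ((continuous_angleReg hα hu).const_mul σ)) ?_ (fun x hx => ?_) t ht
  · simpa [angleReg] using Ioo_subset_Icc_self h0
  · rw [← h.angle_eq hα hs x ⟨hx.1, hx.2.le⟩]
    exact Ioo_subset_Icc_self (h.mul_angle_mem_Ioo hα hu hs hσ h0 x hx)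

/-- While the play lasts, the sign of the separation angle does not change. -/
lemma ae_sign_angle_eq {σ : ℝ} (hα : Measurable α) (hu : DefenderControl u) (hs : 1 < s.R)
    (hσ : σ = 1 ∨ σ = -1) (h0 : σ * s.θ ∈ Ioo 0 (2 * π)) :
    ∀ᵐ t : ℝ, 0 ≤ t → RunningBefore ν s α u t → 1 < radius ν s α t ∧
      Real.sign (angle ν s α u t) = σ := by
  rcases running_or_ends (ν := ν) hα hu hs with h | ⟨T, hT, hrun, -, hend⟩
  · refine Filter.Eventually.of_forall fun t ht _ => ?_
    have ht' : t ∈ Ico 0 (t + 1) := ⟨ht, by linarith⟩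
    exact ⟨(h (t + 1) t ht').1,
      sign_eq_of_mul_pos hσ ((h (t + 1)).mul_angle_mem_Ioo hα hu hs hσ h0 t ht').1⟩
  -- `RunningBefore` at the final time `T` says nothing about `T` itself, where the angle may be
  -- zero; that single time is discarded.
  · filter_upwards [compl_mem_ae_iff.2 (measure_singleton T)] with t htT ht hrt
    have htT' : t < T := by
      refine lt_of_le_of_ne ?_ htT
      by_contra! hlt
      obtain ⟨h1, h2⟩ := hrt T ⟨hT, hlt⟩
      rcases hend with h | h
      · exact absurd h (ne_of_gt h1)
      · exact h2 h
    exact ⟨(hrun t ⟨ht, htT'⟩).1,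
      sign_eq_of_mul_pos hσ (hrun.mul_angle_mem_Ioo hα hu hs hσ h0 t ⟨ht, htT'⟩).1⟩

lemma exists_sign {x : ℝ} (hx : x ≠ 0) : ∃ σ : ℝ, (σ = 1 ∨ σ = -1) ∧ σ * x = |x| := by
  rcases hx.lt_or_gt with h | h
  · exact ⟨-1, Or.inr rfl, by rw [abs_of_neg h]; ring⟩
  · exact ⟨1, Or.inl rfl, by rw [abs_of_pos h]; ring⟩

end CircularDefense

namespace CircularDefense

variable {ν : ℝ} {s : State} {α u : ℝ → ℝ}

/-! ### The variation of the surface along a trajectory -/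

lemma lipschitzWith_radius (hα : Measurable α) : LipschitzWith |ν|.toNNReal (radius ν s α) := by
  refine LipschitzWith.of_dist_le_mul fun x y => ?_
  have h : radius ν s α x - radius ν s α y = ∫ t in y..x, -ν * cos (α t) := by
    rw [radius, radius, add_sub_add_left_eq_sub, intervalIntegral.integral_interval_sub_left] <;>
    exact intervalIntegrable_radiusRate hα _ _
  rw [dist_eq_norm, h, dist_eq_norm, Real.coe_toNNReal _ (abs_nonneg _), Real.norm_eq_abs (x - y)]
  exact intervalIntegral.norm_integral_le_of_norm_le_const fun t _ => abs_radiusRate_le ν α t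

lemma ae_hasDerivAt_radius (hα : Measurable α) :
    ∀ᵐ t : ℝ, HasDerivAt (radius ν s α) (-ν * cos (α t)) t := by
  have hloc : LocallyIntegrable (fun x => -ν * cos (α x)) volume :=
    (locallyIntegrable_const (|ν| : ℝ)).mono (measurable_radiusRate hα).aestronglyMeasurable
      (Filter.Eventually.of_forall fun x => by
        simpa only [Real.norm_eq_abs, abs_abs] using abs_radiusRate_le ν α x)
  filter_upwards [LocallyIntegrable.ae_hasDerivAt_integral hloc] with t ht
  exact (ht 0).const_add _

/-- The chain rule holds only almost everywhere, since the heading is only measurable; absolute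
continuity recovers the increment. -/
lemma surfaceExt_radius_sub (hν : 0 < ν) (hα : Measurable α) (a b : ℝ) :
    surfaceExt ν (radius ν s α b) - surfaceExt ν (radius ν s α a) =
      ∫ x in a..b, surfaceSlope ν (radius ν s α x) * (-ν * cos (α x)) := by
  have hAC := ((lipschitzWith_surfaceExt hν).comp
    (lipschitzWith_radius (ν := ν) (s := s) hα)).lipschitzOnWith
    (s := uIcc a b) |>.absolutelyContinuousOnInterval
  have h := hAC.integral_deriv_eq_sub
  simp only [Function.comp] at h
  rw [← h]
  refine intervalIntegral.integral_congr_ae ?_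
  filter_upwards [ae_hasDerivAt_radius (ν := ν) (s := s) hα] with x hx _
  exact ((hasDerivAt_surfaceExt hν _).comp x hx).deriv

/-- The inner product of the unit vectors `(σ ν / m, q / m)` and `(sin a, cos a)` is at most one,
where `m = max r 1` and `q = tangentLength ν m`. -/
lemma approach_rate_le {σ r a : ℝ} (hν : 0 < ν) (hν1 : ν ≤ 1) (hσ : σ = 1 ∨ σ = -1) :
    σ * (ν / max r 1 * sin a) - 1 ≤ surfaceSlope ν r * (-ν * cos a) := by
  have h1 : 1 ≤ max r 1 := le_max_right _ _
  have h0 : 0 < max r 1 := by linarith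
  have hq := tangentLength_sq hν (hν1.trans h1)
  rw [surfaceSlope]
  set m := max r 1
  set q := tangentLength ν m
  have hAB : (ν / m) ^ 2 + (q / m) ^ 2 = 1 := by
    rw [div_pow, div_pow, hq]; field_simp; ring
  have hσ2 : σ ^ 2 = 1 := by rcases hσ with rfl | rfl <;> norm_num
  have hB : q / (ν * m) * (-ν * cos a) = -(q / m * cos a) := by field_simp
  rw [hB]
  have hσA : (σ * (ν / m)) ^ 2 = (ν / m) ^ 2 := by rw [mul_pow, hσ2, one_mul]
  nlinarith [sq_nonneg (σ * (ν / m) - sin a), sq_nonneg (q / m - cos a), sin_sq_add_cos_sq a]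

/-! ### The defender's feedback -/

/-- No differential equation has to be solved: the sign of the angle cannot change during play, so
the constant control `σ` realizes the feedback. From `θ = 0` the play is already over. -/
lemma exists_defenderFollows (hα : Measurable α) (hs : 1 < s.R) (hθ : |s.θ| ≤ π) :
    ∃ u, DefenderControl u ∧ DefenderFollows ν s α u := by
  rcases eq_or_ne s.θ 0 with h0 | h0
  · refine ⟨fun _ => 0, ⟨measurable_const, fun _ => by simp⟩, ?_⟩
    filter_upwards [compl_mem_ae_iff.2 (measure_singleton (0 : ℝ))] with t ht0 ht hrun
    refine absurd ?_ (hrun 0 ⟨le_rfl, lt_of_le_of_ne ht (Ne.symm ht0)⟩).2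
    simp [State.Aligned, stateAt, h0]
  · obtain ⟨σ, hσ, hσθ⟩ := exists_sign h0
    have hu : DefenderControl fun _ => σ :=
      ⟨measurable_const, fun _ => by rcases hσ with rfl | rfl <;> simp⟩
    refine ⟨_, hu, ?_⟩
    filter_upwards [ae_sign_angle_eq (ν := ν) hα hu hs hσ
      ⟨hσθ ▸ abs_pos.2 h0, by linarith [pi_pos]⟩] with t ht h1 h2
    exact (ht h1 h2).2.symm

section Follows

variable {σ T : ℝ}

lemma DefenderFollows.mul_angle_sub (hfol : DefenderFollows ν s α u) (hα : Measurable α)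
    (hu : DefenderControl u) (hs : 1 < s.R) (hσ : σ = 1 ∨ σ = -1)
    (h0 : σ * s.θ ∈ Ioo 0 (2 * π)) (hrun : RunningBefore ν s α u T) {a b : ℝ} (ha : 0 ≤ a)
    (hab : a ≤ b) (hb : b ≤ T) :
    σ * angle ν s α u b - σ * angle ν s α u a =
      ∫ x in a..b, (σ * (ν / max (radius ν s α x) 1 * sin (α x)) - 1) := by
  rw [hrun.angle_eq hα hs b ⟨ha.trans hab, hb⟩, hrun.angle_eq hα hs a ⟨ha, hab.trans hb⟩,
    ← mul_sub, angleReg, angleReg, add_sub_add_left_eq_sub,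
    intervalIntegral.integral_interval_sub_left (intervalIntegrable_angleRate hα hu _ _)
      (intervalIntegrable_angleRate hα hu _ _), ← intervalIntegral.integral_const_mul]
  refine intervalIntegral.integral_congr_ae ?_
  filter_upwards [ae_sign_angle_eq (ν := ν) hα hu hs hσ h0, hfol] with x h1 h2 hx
  rw [uIoc_of_le hab] at hx
  have hx0 : 0 ≤ x := ha.trans hx.1.le
  have hrx := hrun.mono (hx.2.trans hb)
  rw [angleRate, h2 hx0 hrx]
  change σ * (_ - Real.sign (angle ν s α u x)) = _
  rw [(h1 hx0 hrx).2]
  rcases hσ with rfl | rfl <;> ring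

lemma intervalIntegrable_mul_rate (hα : Measurable α) (hσ : σ = 1 ∨ σ = -1) (a b : ℝ) :
    IntervalIntegrable (fun x => σ * (ν / max (radius ν s α x) 1 * sin (α x)) - 1)
      volume a b := by
  refine intervalIntegrable_of_abs_le (C := |ν| + 1) (Measurable.sub_const (Measurable.const_mul
    ((measurable_const.div ((continuous_radius hα).measurable.max measurable_const)).mul
      (measurable_sin.comp hα)) _) _) (fun x => ?_) a b
  refine (abs_sub _ _).trans ?_
  rw [abs_one, abs_mul_sign hσ]
  exact add_le_add_left (abs_div_max_mul_sin_le _ _ _) _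

/-- Under `u*` the separation in excess of the surface does not increase. -/
lemma DefenderFollows.mul_angle_sub_thetaG_le (hfol : DefenderFollows ν s α u) (hν : 0 < ν)
    (hν1 : ν ≤ 1) (hα : Measurable α) (hu : DefenderControl u) (hs : 1 < s.R)
    (hσ : σ = 1 ∨ σ = -1) (h0 : σ * s.θ ∈ Ioo 0 (2 * π)) (hrun : RunningBefore ν s α u T) {t : ℝ}
    (ht : t ∈ Icc 0 T) :
    σ * angle ν s α u t - thetaG ν (radius ν s α t) ≤ σ * s.θ - thetaG ν s.R := by
  have h1 := hfol.mul_angle_sub hα hu hs hσ h0 hrun le_rfl ht.1 ht.2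
  have h2 := surfaceExt_radius_sub (s := s) hν hα 0 t
  have h3 : (∫ x in (0 : ℝ)..t, (σ * (ν / max (radius ν s α x) 1 * sin (α x)) - 1)) ≤
      ∫ x in (0 : ℝ)..t, surfaceSlope ν (radius ν s α x) * (-ν * cos (α x)) := by
    refine intervalIntegral.integral_mono_on ht.1 (intervalIntegrable_mul_rate hα hσ _ _) ?_
      fun x _ => approach_rate_le hν hν1 hσ
    refine intervalIntegrable_of_abs_le (C := 1 / ν * |ν|)
      ((((continuous_surfaceSlope hν).comp (continuous_radius hα)).measurable).mul
        (measurable_radiusRate hα)) (fun x => ?_) _ _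
    rw [Pi.mul_apply, abs_mul]
    exact mul_le_mul (abs_surfaceSlope_le hν _) (abs_radiusRate_le ν α x) (abs_nonneg _)
      (by positivity)
  rw [surfaceExt_eq hν hν1 (hrun.one_le_radius hα hs t ht), radius_zero,
    surfaceExt_eq hν hν1 hs.le] at h2
  rw [angle_zero] at h1
  linarith

/-- The attacker's angular speed is at most `ν / R`, so a defender at full speed closes in at least
at rate `1 - ν / R`. This gives the finite time of interception and the monotonicity of `|θ|`. -/
lemma DefenderFollows.mul_angle_sub_le (hfol : DefenderFollows ν s α u) (hν : 0 < ν)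
    (hα : Measurable α) (hu : DefenderControl u) (hs : 1 < s.R) (hσ : σ = 1 ∨ σ = -1)
    (h0 : σ * s.θ ∈ Ioo 0 (2 * π)) (hrun : RunningBefore ν s α u T) {a b : ℝ} (ha : 0 ≤ a)
    (hab : a ≤ b) (hb : b ≤ T) :
    (∫ x in a..b, (1 - ν / max (radius ν s α x) 1)) ≤
      σ * angle ν s α u a - σ * angle ν s α u b := by
  have h1 := hfol.mul_angle_sub hα hu hs hσ h0 hrun ha hab hb
  have h2 : (∫ x in a..b, (1 - ν / max (radius ν s α x) 1)) ≤
      ∫ x in a..b, -(σ * (ν / max (radius ν s α x) 1 * sin (α x)) - 1) := by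
    refine intervalIntegral.integral_mono_on hab (Continuous.intervalIntegrable ?_ _ _)
      (intervalIntegrable_mul_rate hα hσ _ _).neg fun x _ => ?_
    · have := continuous_radius (ν := ν) (s := s) hα
      have hne : ∀ x, max (radius ν s α x) 1 ≠ 0 := fun x => by positivity
      fun_prop (disch := assumption)
    · have hm : 0 < max (radius ν s α x) 1 := by positivity
      have hd : 0 < ν / max (radius ν s α x) 1 := by positivity
      have hle : σ * sin (α x) ≤ 1 := by
        refine (le_abs_self _).trans ?_
        rw [abs_mul_sign hσ]
        exact abs_sin_le_one _
      nlinarith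
  rw [intervalIntegral.integral_neg] at h2
  linarith

lemma one_sub_le_one_sub_div_max (hν : 0 < ν) (r : ℝ) : 1 - ν ≤ 1 - ν / max r 1 :=
  sub_le_sub_left (div_le_self hν.le (le_max_right _ _)) _

/-- Under `u*` the separation angle cannot stay between `0` and the surface forever. -/
lemma DefenderFollows.exists_not_running (hfol : DefenderFollows ν s α u) (hν : 0 < ν)
    (hν1 : ν ≤ 1) (hα : Measurable α) (hu : DefenderControl u) (hs : 1 < s.R)
    (hσ : σ = 1 ∨ σ = -1) (h0 : 0 < σ * s.θ) (hπ : σ * s.θ ≤ π)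
    (hG : σ * s.θ ≤ thetaG ν s.R) : ∃ T, ¬ RunningBefore ν s α u T := by
  by_contra! hrun
  have h0' : σ * s.θ ∈ Ioo 0 (2 * π) := ⟨h0, by linarith [pi_pos]⟩
  have hcont : Continuous fun x => 1 - ν / max (radius ν s α x) 1 := by
    have := continuous_radius (ν := ν) (s := s) hα
    have hne : ∀ x, max (radius ν s α x) 1 ≠ 0 := fun x => by positivity
    fun_prop (disch := assumption)
  have hw0 : ∀ x, 0 ≤ 1 - ν / max (radius ν s α x) 1 := fun x =>
    (sub_nonneg.2 hν1).trans (one_sub_le_one_sub_div_max hν _)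
  have hpos : ∀ t, 0 ≤ t → 0 < σ * angle ν s α u t := fun t ht =>
    ((hrun (t + 1)).mul_angle_mem_Ioo hα hu hs hσ h0' t ⟨ht, by linarith⟩).1
  have hdec : ∀ a b, 0 ≤ a → a ≤ b → (∫ x in a..b, (1 - ν / max (radius ν s α x) 1)) ≤
      σ * angle ν s α u a - σ * angle ν s α u b := fun a b ha hab =>
    hfol.mul_angle_sub_le hν hα hu hs hσ h0' (hrun b) ha hab le_rfl
  rcases hν1.lt_or_eq with hlt | rfl
  · set T := σ * s.θ / (1 - ν) with hT
    have hT0 : 0 ≤ T := div_nonneg h0.le (by linarith)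
    have h1 := hdec 0 T le_rfl hT0
    have h2 : (∫ _ in (0 : ℝ)..T, (1 - ν)) ≤ ∫ x in (0 : ℝ)..T,
        (1 - ν / max (radius ν s α x) 1) :=
      intervalIntegral.integral_mono_on hT0 (by simp) (hcont.intervalIntegrable _ _)
        fun x _ => one_sub_le_one_sub_div_max hν _
    rw [intervalIntegral.integral_const, smul_eq_mul, sub_zero, hT,
      div_mul_cancel₀ _ (by linarith)] at h2
    rw [angle_zero] at h1
    linarith [hpos T hT0]
  · set w : ℝ → ℝ := fun x => 1 - 1 / max (radius 1 s α x) 1 with hw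
    -- The comparison below makes `Y ^ (1 / 3)` fall at rate at least `1 / 18`, starting from at
    -- most `π ^ (1 / 3) ≤ 4 ^ (1 / 3)`.
    have hbound : ∀ N : ℝ, 0 ≤ N → N ≤ 18 * 4 ^ (1 / 3 : ℝ) := by
      intro N hN
      -- A differentiable positive minorant of the separation on `[0, N]`, with equality at `N` and
      -- derivative exactly `-w`. The separation itself satisfies only an integral inequality.
      set Y : ℝ → ℝ := fun t => σ * angle 1 s α u N - ∫ x in N..t, w x with hY
      have hYd : ∀ t, HasDerivAt Y (-w t) t := fun t =>
        ((hcont.integral_hasStrictDerivAt N t).hasDerivAt).const_sub _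
      have hYpos : ∀ t ∈ Icc 0 N, 0 < Y t := fun t ht => by
        have : 0 ≤ ∫ x in t..N, w x := intervalIntegral.integral_nonneg ht.2 fun x _ => hw0 x
        rw [hY]
        simp only
        rw [intervalIntegral.integral_symm]
        linarith [hpos N hN]
      have hYle : ∀ t ∈ Icc 0 N, Y t ≤ σ * angle 1 s α u t := fun t ht => by
        have := hdec t N ht.1 ht.2
        rw [hY]
        simp only
        rw [intervalIntegral.integral_symm]
        linarith
      have hlepi : ∀ t ∈ Icc 0 N, σ * angle 1 s α u t ≤ π := fun t ht => by
        have h1 := hdec 0 t le_rfl ht.1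
        have : 0 ≤ ∫ x in (0 : ℝ)..t, w x := intervalIntegral.integral_nonneg ht.1 fun x _ => hw0 x
        rw [angle_zero] at h1
        linarith
      have hsq : ∀ t ∈ Icc 0 N, Y t ^ 2 ≤ 216 * w t ^ 3 := fun t ht => by
        have hR := (hrun N).one_le_radius hα hs t ht
        have h1 := hfol.mul_angle_sub_thetaG_le hν hν1 hα hu hs hσ h0' (hrun N) ht
        have h2 := sq_le_of_le_thetaG_one hR (hpos t ht.1).le (hlepi t ht) (by linarith)
        rw [hw]
        simp only [max_eq_left hR]
        exact (pow_le_pow_left₀ (hYpos t ht).le (hYle t ht) 2).trans h2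
      have hZd : ∀ t ∈ Icc 0 N, HasDerivAt (fun t => Y t ^ (1 / 3 : ℝ) + t / 18)
          (-w t * (1 / 3) * Y t ^ (1 / 3 - 1 : ℝ) + 1 / 18) t := fun t ht =>
        ((hYd t).rpow_const (Or.inl (hYpos t ht).ne')).add ((hasDerivAt_id t).div_const 18)
      -- From `Y ^ 2 ≤ 216 * w ^ 3` follows `Y ^ (2 / 3) ≤ 6 * w`, hence `(Y ^ (1 / 3))' ≤ -1 / 18`.
      have hZ' : ∀ t ∈ Icc 0 N, -w t * (1 / 3) * Y t ^ (1 / 3 - 1 : ℝ) + 1 / 18 ≤ 0 := by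
        intro t ht
        have hY0 := hYpos t ht
        have hc : (Y t ^ (2 / 3 : ℝ)) ^ 3 = Y t ^ 2 := by
          rw [← rpow_natCast, ← rpow_mul hY0.le, ← rpow_natCast]; norm_num
        have h1 : Y t ^ (2 / 3 : ℝ) ≤ 6 * w t := by
          refine le_of_pow_le_pow_left₀ (n := 3) (by norm_num) (by linarith [hw0 t]) ?_
          rw [hc]
          linarith [hsq t ht]
        have h2 : Y t ^ (1 / 3 - 1 : ℝ) * Y t ^ (2 / 3 : ℝ) = 1 := by
          rw [← rpow_add hY0]; norm_num
        have h3 : 0 < Y t ^ (1 / 3 - 1 : ℝ) := rpow_pos_of_pos hY0 _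
        nlinarith
      have hanti : AntitoneOn (fun t => Y t ^ (1 / 3 : ℝ) + t / 18) (Icc 0 N) := by
        refine antitoneOn_of_deriv_nonpos (convex_Icc 0 N)
          (fun t ht => (hZd t ht).continuousAt.continuousWithinAt)
          (fun t ht => (hZd t (interior_subset ht)).differentiableAt.differentiableWithinAt)
          fun t ht => ?_
        rw [(hZd t (interior_subset ht)).deriv]
        exact hZ' t (interior_subset ht)
      have h1 := hanti ⟨le_rfl, hN⟩ ⟨hN, le_rfl⟩ hN
      simp only [zero_div, add_zero] at h1
      have h2 : 0 ≤ Y N ^ (1 / 3 : ℝ) := rpow_nonneg (hYpos N ⟨hN, le_rfl⟩).le _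
      have h3 : Y 0 ^ (1 / 3 : ℝ) ≤ 4 ^ (1 / 3 : ℝ) :=
        rpow_le_rpow (hYpos 0 ⟨le_rfl, hN⟩).le
          ((hYle 0 ⟨le_rfl, hN⟩).trans ((hlepi 0 ⟨le_rfl, hN⟩).trans pi_le_four)) (by norm_num)
      linarith
    have h4 : (0 : ℝ) ≤ 4 ^ (1 / 3 : ℝ) := by positivity
    linarith [hbound (18 * 4 ^ (1 / 3 : ℝ) + 1) (by linarith)]

end Follows

lemma State.aligned_of_eq_zero (h : s.θ = 0) : s.Aligned := by
  simp [State.Aligned, h]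

/-- From the defender's region `u*` intercepts, not closer to the target than the level of
the surface allows. -/
lemma DefenderFollows.exists_interceptsAt (hfol : DefenderFollows ν s α u) (hν : 0 < ν)
    (hν1 : ν ≤ 1) (hα : Measurable α) (hu : DefenderControl u) (hs : 1 < s.R) (hπ : |s.θ| ≤ π)
    (hG : |s.θ| ≤ thetaG ν s.R) :
    ∃ T, InterceptsAt ν s α u T ∧ thetaG ν s.R - |s.θ| ≤ thetaG ν (radius ν s α T) := by
  rcases eq_or_ne s.θ 0 with h0 | h0
  · refine ⟨0, ⟨le_rfl, fun t ht => absurd ht.2 (not_lt.2 ht.1), ?_, ?_⟩, ?_⟩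
    · simpa [stateAt] using hs.le
    · exact State.aligned_of_eq_zero (by simpa [stateAt] using h0)
    · simp
  obtain ⟨σ, hσ, hσθ⟩ := exists_sign h0
  have h0' : σ * s.θ ∈ Ioo 0 (2 * π) := ⟨hσθ ▸ abs_pos.2 h0, by linarith [pi_pos]⟩
  rcases running_or_ends (ν := ν) hα hu hs with h | ⟨T, hT, hrun, hR, hend⟩
  · obtain ⟨T, hT⟩ := hfol.exists_not_running hν hν1 hα hu hs hσ h0'.1 (hσθ ▸ hπ) (hσθ ▸ hG)
    exact absurd (h T) hT
  have hL := hfol.mul_angle_sub_thetaG_le hν hν1 hα hu hs hσ h0' hrun ⟨hT, le_rfl⟩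
  have hmem := hrun.mul_angle_mem_Icc hα hu hs hσ h0' T ⟨hT, le_rfl⟩
  refine ⟨T, ⟨hT, hrun, hR, ?_⟩, by linarith [hmem.1]⟩
  rcases hend with h | h
  -- The surface vanishes at the target, so a nonpositive excess forces angle zero: arriving there
  -- coincides with interception.
  · rw [h, thetaG_one] at hL
    have : σ * angle ν s α u T = 0 := le_antisymm (by linarith) hmem.1
    have : angle ν s α u T = 0 := by
      rcases hσ with rfl | rfl <;> linarith
    exact State.aligned_of_eq_zero this
  · exact h

lemma DefenderFollows.abs_angle_le (hfol : DefenderFollows ν s α u) (hν : 0 < ν)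
    (hν1 : ν ≤ 1) (hα : Measurable α) (hu : DefenderControl u) (hs : 1 < s.R) (hπ : |s.θ| ≤ π)
    {T : ℝ} (hrun : RunningBefore ν s α u T) {t : ℝ} (ht : t ∈ Icc 0 T) :
    |angle ν s α u t| ≤ |s.θ| ∧
      |angle ν s α u t| - thetaG ν (radius ν s α t) ≤ |s.θ| - thetaG ν s.R := by
  rcases eq_or_ne s.θ 0 with h0 | h0
  · have hT : T ≤ 0 := by
      by_contra! hT
      exact (hrun 0 ⟨le_rfl, hT⟩).2 (State.aligned_of_eq_zero (by simpa [stateAt] using h0))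
    have : t = 0 := le_antisymm (ht.2.trans hT) ht.1
    subst this
    simp
  obtain ⟨σ, hσ, hσθ⟩ := exists_sign h0
  have h0' : σ * s.θ ∈ Ioo 0 (2 * π) := ⟨hσθ ▸ abs_pos.2 h0, by linarith [pi_pos]⟩
  have hmem := hrun.mul_angle_mem_Icc hα hu hs hσ h0' t ht
  rw [← abs_mul_sign hσ, abs_of_nonneg hmem.1, ← hσθ]
  refine ⟨?_, hfol.mul_angle_sub_thetaG_le hν hν1 hα hu hs hσ h0' hrun ht⟩
  have h1 := hfol.mul_angle_sub_le hν hα hu hs hσ h0' hrun le_rfl ht.1 ht.2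
  have h2 : 0 ≤ ∫ x in (0 : ℝ)..t, (1 - ν / max (radius ν s α x) 1) :=
    intervalIntegral.integral_nonneg ht.1 fun x _ =>
      (sub_nonneg.2 hν1).trans (one_sub_le_one_sub_div_max hν _)
  rw [angle_zero] at h1
  linarith

/-! ### The defender's half of the saddle point -/

lemma separation_le_abs (hs : |s.θ| ≤ π) : s.separation = |s.θ| := by
  rw [State.separation]
  rcases le_total 0 s.θ with h | h
  · rw [abs_of_nonneg h] at hs ⊢
    exact Real.Angle.abs_toReal_coe_eq_self_iff.2 ⟨h, hs⟩
  · rw [abs_of_nonpos h] at hs ⊢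
    have := Real.Angle.abs_toReal_neg_coe_eq_self_iff.2 ⟨neg_nonneg.2 h, hs⟩
    simpa using this

lemma defenderSecures {ℓ : ℝ → ℝ} (hν : 0 < ν) (hν1 : ν ≤ 1) (hs : 1 < s.R) (hπ : |s.θ| ≤ π)
    (hℓ : ∀ r, 1 ≤ r → 0 ≤ ℓ r) :
    DefenderSecures ν ℓ s (max (|s.θ| - thetaG ν s.R) 0) := by
  intro α τ hα hτ
  refine ⟨exists_defenderFollows hα.1 hs hπ, fun u hu hfol => ?_⟩
  have hw : ∀ T : ℝ, 0 ≤ T → τ = T → RunningBefore ν s α u T →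
      ∃ o, HasOutcome ν s α τ u o ∧ payoff ℓ o ≤ max (|s.θ| - thetaG ν s.R) 0 :=
    fun T h1 h2 h3 => ⟨.withdrawal, ⟨T, h1, h2, h3⟩, le_max_right _ _⟩
  have hτr : τ ≠ ⊤ → ∃ t : ℝ, 0 ≤ t ∧ τ = t := fun h => by
    lift τ to ℝ using ⟨h, fun h' => by simp [h'] at hτ⟩
    exact ⟨τ, by exact_mod_cast hτ, rfl⟩
  rcases running_or_ends (ν := ν) hα.1 hu hs with h | ⟨T, hT, hrun, hR, hend⟩
  · rcases eq_or_ne τ ⊤ with h' | h'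
    · exact ⟨.undecided, ⟨h', h⟩, le_max_right _ _⟩
    · obtain ⟨t, ht, rfl⟩ := hτr h'
      exact hw t ht rfl (h t)
  -- If the play ends before the attacker stops, the excess bounds a penetration and the sign of `ℓ`
  -- an interception. Otherwise, a tie included, the outcome is withdrawal.
  rcases lt_or_ge (T : EReal) τ with hTτ | hTτ
  · by_cases hal : (stateAt ν s α u T).Aligned
    · refine ⟨.interception (radius ν s α T), ⟨T, hTτ, ⟨hT, hrun, hR, hal⟩, rfl⟩, ?_⟩
      exact (neg_nonpos.2 (hℓ _ hR)).trans (le_max_right _ _)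
    · have hR1 := hend.resolve_right hal
      refine ⟨.penetration _, ⟨T, hTτ, ⟨hT, hrun, hR1, hal⟩, rfl⟩, ?_⟩
      obtain ⟨h1, h2⟩ := hfol.abs_angle_le hν hν1 hα.1 hu hs hπ hrun ⟨hT, le_rfl⟩
      rw [payoff, separation_le_abs (s := stateAt ν s α u T) (h1.trans hπ)]
      rw [hR1, thetaG_one, sub_zero] at h2
      exact h2.trans (le_max_left _ _)
  · obtain ⟨t, ht, rfl⟩ := hτr (ne_top_of_le_ne_top (EReal.coe_ne_top T) hTτ)
    exact hw t ht rfl (hrun.mono (by exact_mod_cast hTτ))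

end CircularDefense

namespace CircularDefense

variable {ν : ℝ} {s : State} {α u : ℝ → ℝ}

/-! ### Tangential attacks -/

/-- The distance from the centre at time `t` of an attacker moving at speed `ν` from distance `R`
along a tangent to the circle of radius `ν`. -/
noncomputable def tangentRadius (ν R t : ℝ) : ℝ := √(ν ^ 2 + (tangentLength ν R - ν * t) ^ 2)

/-- The time at which this attacker reaches the target. -/
noncomputable def arrivalTime (ν R : ℝ) : ℝ := (tangentLength ν R - tangentLength ν 1) / ν

/-- The polar angle swept by this attacker until time `t`. -/
noncomputable def sweptAngle (ν R t : ℝ) : ℝ :=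
  arctan (tangentLength ν R / ν) - arctan ((tangentLength ν R - ν * t) / ν)

section Tangent

variable {R t : ℝ}

lemma tangentRadius_sq (ν R t : ℝ) :
    tangentRadius ν R t ^ 2 = ν ^ 2 + (tangentLength ν R - ν * t) ^ 2 :=
  sq_sqrt (by positivity)

lemma le_tangentRadius (ν R t : ℝ) : ν ≤ tangentRadius ν R t :=
  le_sqrt_of_sq_le (by nlinarith [sq_nonneg (tangentLength ν R - ν * t)])

lemma continuous_tangentRadius (ν R : ℝ) : Continuous (tangentRadius ν R) := by
  unfold tangentRadius; fun_prop

lemma tangentRadius_zero (hν : 0 < ν) (hR : ν ≤ R) : tangentRadius ν R 0 = R := by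
  rw [tangentRadius, mul_zero, sub_zero, tangentLength_sq hν hR, add_sub_cancel,
    sqrt_sq (hν.le.trans hR)]

lemma arrivalTime_pos (hν : 0 < ν) (hν1 : ν ≤ 1) (hR : 1 < R) : 0 < arrivalTime ν R :=
  div_pos (sub_pos.2 (tangentLength_strictMono hν hν1 hR)) hν

lemma tangentLength_one_le (hν : 0 < ν) (ht : t ≤ arrivalTime ν R) :
    tangentLength ν 1 ≤ tangentLength ν R - ν * t := by
  rw [arrivalTime, le_div_iff₀ hν] at ht
  linarith

lemma tangentLength_one_lt (hν : 0 < ν) (ht : t < arrivalTime ν R) :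
    tangentLength ν 1 < tangentLength ν R - ν * t := by
  rw [arrivalTime, lt_div_iff₀ hν] at ht
  linarith

lemma one_le_tangentRadius (hν : 0 < ν) (hν1 : ν ≤ 1) (ht : t ≤ arrivalTime ν R) :
    1 ≤ tangentRadius ν R t := by
  have h1 := tangentLength_one_le hν ht
  have h2 := tangentLength_sq hν hν1
  have h3 := tangentLength_nonneg ν 1
  exact le_sqrt_of_sq_le (by nlinarith)

lemma one_lt_tangentRadius (hν : 0 < ν) (hν1 : ν ≤ 1) (ht : t < arrivalTime ν R) :
    1 < tangentRadius ν R t := by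
  have h1 := tangentLength_one_lt hν ht
  have h2 := tangentLength_sq hν hν1
  have h3 := tangentLength_nonneg ν 1
  exact lt_sqrt_of_sq_lt (by nlinarith)

lemma tangentRadius_arrivalTime (hν : 0 < ν) (hν1 : ν ≤ 1) :
    tangentRadius ν R (arrivalTime ν R) = 1 := by
  rw [tangentRadius, arrivalTime, mul_div_cancel₀ _ hν.ne', sub_sub_cancel,
    tangentLength_sq hν hν1]
  norm_num

lemma tangentLength_tangentRadius (hν : 0 < ν) (ht : t ≤ arrivalTime ν R) :
    tangentLength ν (tangentRadius ν R t) = tangentLength ν R - ν * t := by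
  rw [tangentLength, tangentRadius_sq, add_sub_cancel_left,
    sqrt_sq ((tangentLength_nonneg ν 1).trans (tangentLength_one_le hν ht))]

lemma tangentRadius_le (hν : 0 < ν) (hR : ν ≤ R) (h0 : 0 ≤ t) (ht : t ≤ arrivalTime ν R) :
    tangentRadius ν R t ≤ R := by
  have h1 := (tangentLength_nonneg ν 1).trans (tangentLength_one_le hν ht)
  have h2 := tangentLength_sq hν hR
  have h3 := mul_nonneg hν.le h0
  exact (sqrt_le_left (hν.le.trans hR)).2 (by nlinarith)

lemma hasDerivAt_tangentRadius (hν : 0 < ν) (R t : ℝ) :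
    HasDerivAt (tangentRadius ν R)
      (-ν * ((tangentLength ν R - ν * t) / tangentRadius ν R t)) t := by
  have h1 : HasDerivAt (fun t => ν ^ 2 + (tangentLength ν R - ν * t) ^ 2)
      (2 * (tangentLength ν R - ν * t) * (-ν)) t := by
    have := ((((hasDerivAt_id t).const_mul ν).const_sub (tangentLength ν R)).pow 2).const_add (ν ^ 2)
    exact this.congr_deriv (by simp)
  refine (h1.sqrt (by positivity)).congr_deriv ?_
  have := hν.trans_le (le_tangentRadius ν R t)
  rw [show √(ν ^ 2 + (tangentLength ν R - ν * t) ^ 2) = tangentRadius ν R t from rfl]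
  field_simp

lemma hasDerivAt_sweptAngle (hν : 0 < ν) (R t : ℝ) :
    HasDerivAt (sweptAngle ν R) (ν ^ 2 / tangentRadius ν R t ^ 2) t := by
  have h1 : HasDerivAt (fun t => (tangentLength ν R - ν * t) / ν) (-1) t := by
    refine (((((hasDerivAt_id t).const_mul ν).const_sub (tangentLength ν R))).div_const
      ν).congr_deriv ?_
    field_simp
  refine (h1.arctan.const_sub (arctan (tangentLength ν R / ν))).congr_deriv ?_
  rw [tangentRadius_sq]
  field_simp

lemma continuous_sweptRate (hν : 0 < ν) (R : ℝ) :
    Continuous fun t => ν ^ 2 / tangentRadius ν R t ^ 2 := by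
  have h := continuous_tangentRadius ν R
  have hne : ∀ t, tangentRadius ν R t ^ 2 ≠ 0 := fun t =>
    (pow_pos (hν.trans_le (le_tangentRadius ν R t)) 2).ne'
  fun_prop (disch := assumption)

lemma integral_sweptRate (hν : 0 < ν) (R a b : ℝ) :
    ∫ x in a..b, ν ^ 2 / tangentRadius ν R x ^ 2 = sweptAngle ν R b - sweptAngle ν R a :=
  intervalIntegral.integral_eq_sub_of_hasDerivAt (fun x _ => hasDerivAt_sweptAngle hν R x)
    ((continuous_sweptRate hν R).intervalIntegrable _ _)

@[simp] lemma sweptAngle_zero (ν R : ℝ) : sweptAngle ν R 0 = 0 := by simp [sweptAngle]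

/-- The attacker has not yet passed the foot of the tangent, so the swept angle is a difference of
arctangents of nonnegative numbers. -/
lemma sweptAngle_lt (hν : 0 < ν) (ht : t ≤ arrivalTime ν R) : sweptAngle ν R t < π / 2 := by
  have h1 := (tangentLength_nonneg ν 1).trans (tangentLength_one_le hν ht)
  have h2 : 0 ≤ arctan ((tangentLength ν R - ν * t) / ν) :=
    arctan_nonneg.2 (div_nonneg h1 hν.le)
  have h3 := arctan_lt_pi_div_two (tangentLength ν R / ν)
  rw [sweptAngle]
  linarith

/-- Elapsed time is the angle that a defender at full speed covers. The drop of the surface is thus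
exactly what such a defender gains on a tangential attacker fleeing from it. -/
lemma thetaG_sub_thetaG_tangentRadius (hν : 0 < ν) (hν1 : ν ≤ 1) (hR : 1 ≤ R)
    (ht : t ≤ arrivalTime ν R) :
    thetaG ν R - thetaG ν (tangentRadius ν R t) = t - sweptAngle ν R t := by
  rw [thetaG_eq hν hν1 hR, thetaG_eq hν hν1 (one_le_tangentRadius hν hν1 ht),
    tangentLength_tangentRadius hν ht, sweptAngle]
  field_simp
  ring

end Tangent

variable {T : ℝ} {σ : ℝ → ℝ}

lemma cos_mul_sign {c x : ℝ} (hc : c = 1 ∨ c = -1) : cos (c * x) = cos x := by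
  rcases hc with rfl | rfl <;> simp

lemma sin_mul_sign {c x : ℝ} (hc : c = 1 ∨ c = -1) : sin (c * x) = c * sin x := by
  rcases hc with rfl | rfl <;> simp

lemma radius_eq_tangentRadius (hν : 0 < ν) (hν1 : ν ≤ 1) (hs : 1 < s.R)
    (hσ : ∀ t, σ t = 1 ∨ σ t = -1) (hT : T ≤ arrivalTime ν s.R)
    (h : ∀ᵐ t : ℝ, t ∈ Ico 0 T → α t = σ t * arcsin (ν / tangentRadius ν s.R t)) :
    ∀ t ∈ Icc 0 T, radius ν s α t = tangentRadius ν s.R t := by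
  intro t ht
  have h1 : ∫ x in (0 : ℝ)..t, -ν * cos (α x) = ∫ x in (0 : ℝ)..t,
      -ν * ((tangentLength ν s.R - ν * x) / tangentRadius ν s.R x) := by
    refine intervalIntegral.integral_congr_ae ?_
    filter_upwards [h, compl_mem_ae_iff.2 (measure_singleton T)] with x hx hxT hxt
    rw [uIoc_of_le ht.1] at hxt
    have hxT' : x < T := lt_of_le_of_ne (hxt.2.trans ht.2) hxT
    rw [hx ⟨hxt.1.le, hxT'⟩, cos_mul_sign (hσ x),
      cos_arcsin_div (hν.trans_le (le_tangentRadius _ _ _)),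
      tangentLength_tangentRadius hν (hxT'.le.trans hT)]
  have hcont : Continuous fun x =>
      -ν * ((tangentLength ν s.R - ν * x) / tangentRadius ν s.R x) := by
    have := continuous_tangentRadius ν s.R
    have hne : ∀ t, tangentRadius ν s.R t ≠ 0 := fun t =>
      (hν.trans_le (le_tangentRadius ν s.R t)).ne'
    fun_prop (disch := assumption)
  rw [radius, h1, intervalIntegral.integral_eq_sub_of_hasDerivAt
    (fun x _ => hasDerivAt_tangentRadius hν s.R x) (hcont.intervalIntegrable _ _),
    tangentRadius_zero hν (hν1.trans hs.le), add_sub_cancel]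

lemma angle_eq_of_tangent (hν : 0 < ν) (hσ : ∀ t, σ t = 1 ∨ σ t = -1)
    (h : ∀ᵐ t : ℝ, t ∈ Ico 0 T → α t = σ t * arcsin (ν / tangentRadius ν s.R t))
    (hR : ∀ t ∈ Icc 0 T, radius ν s α t = tangentRadius ν s.R t) :
    ∀ t ∈ Icc 0 T, angle ν s α u t =
      s.θ + ∫ x in (0 : ℝ)..t, (σ x * (ν ^ 2 / tangentRadius ν s.R x ^ 2) - u x) := by
  intro t ht
  rw [angle]
  congr 1
  refine intervalIntegral.integral_congr_ae ?_
  filter_upwards [h, compl_mem_ae_iff.2 (measure_singleton T)] with x hx hxT hxt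
  rw [uIoc_of_le ht.1] at hxt
  have hxT' : x < T := lt_of_le_of_ne (hxt.2.trans ht.2) hxT
  have h0 := hν.trans_le (le_tangentRadius ν s.R x)
  rw [hx ⟨hxt.1.le, hxT'⟩, sin_mul_sign (hσ x), sin_arcsin_div hν (le_tangentRadius _ _ _),
    hR x ⟨hxt.1.le, hxT'.le⟩]
  congr 1
  field_simp

/-- An attacker who heads along the tangents has the distance `tangentRadius` from the centre. -/
lemma radius_eq_tangentRadius_of_feedback (hν : 0 < ν) (hν1 : ν ≤ 1) (hα : Measurable α)
    (hs : 1 < s.R) (hσ : ∀ t, σ t = 1 ∨ σ t = -1)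
    (hR : ∀ t ∈ Ico 0 T, 1 < radius ν s α t)
    (h : ∀ᵐ t : ℝ, t ∈ Ico 0 T → α t = σ t * arcsin (ν / radius ν s α t)) :
    ∀ t ∈ Icc 0 T, t ≤ arrivalTime ν s.R ∧ radius ν s α t = tangentRadius ν s.R t := by
  have hRc := continuous_radius (ν := ν) (s := s) hα
  -- The feedback holds only almost everywhere; replacing `cos (α x)` by this continuous function
  -- exhibits the radius as continuously differentiable.
  set c : ℝ → ℝ := fun x => tangentLength ν (max (radius ν s α x) 1) / max (radius ν s α x) 1
    with hc
  have hcc : Continuous c := by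
    have h1 := continuous_tangentLength ν
    have hne : ∀ x, max (radius ν s α x) 1 ≠ 0 := fun x => by positivity
    rw [hc]
    fun_prop (disch := assumption)
  have hint : ∀ t ∈ Icc 0 T, radius ν s α t = s.R + ∫ x in (0 : ℝ)..t, -ν * c x := by
    intro t ht
    rw [radius]
    congr 1
    refine intervalIntegral.integral_congr_ae ?_
    filter_upwards [h, compl_mem_ae_iff.2 (measure_singleton T)] with x hx hxT hxt
    rw [uIoc_of_le ht.1] at hxt
    have hxT' : x < T := lt_of_le_of_ne (hxt.2.trans ht.2) hxT
    have h1 := hR x ⟨hxt.1.le, hxT'⟩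
    rw [hx ⟨hxt.1.le, hxT'⟩, cos_mul_sign (hσ x), cos_arcsin_div (by linarith), hc]
    simp only [max_eq_left h1.le]
  set f : ℝ → ℝ := fun t => tangentLength ν (s.R + ∫ x in (0 : ℝ)..t, -ν * c x) + ν * t with hf
  -- The tangent length turns the nonlinear equation for the radius into `q' = -ν`. This determines
  -- the trajectory although, for `ν = 1`, the right-hand side is not Lipschitz at `R = 1`.
  have hq : ∀ t ∈ Icc 0 T, tangentLength ν (radius ν s α t) = tangentLength ν s.R - ν * t := by
    have hconst := constant_of_has_deriv_right_zero (f := f) (a := 0) (b := T) ?_ ?_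
    · intro t ht
      have h1 := hconst t ht
      simp only [hf, intervalIntegral.integral_same, add_zero, mul_zero] at h1
      rw [hint t ht]
      linarith
    · have h1 := continuous_tangentLength ν
      have h2 : Continuous fun t => ∫ x in (0 : ℝ)..t, -ν * c x :=
        intervalIntegral.continuous_primitive
          (fun a b => (hcc.const_mul _).intervalIntegrable a b) 0
      exact Continuous.continuousOn (by fun_prop)
    · intro t ht
      have h1 := hR t ht
      have h2 := hint t ⟨ht.1, ht.2.le⟩
      have hd : HasDerivAt (fun t => s.R + ∫ x in (0 : ℝ)..t, -ν * c x) (-ν * c t) t :=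
        ((hcc.const_mul _).integral_hasStrictDerivAt 0 t).hasDerivAt.const_add _
      have hpos : 0 < tangentLength ν (radius ν s α t) :=
        tangentLength_pos hν (hν1.trans_lt h1)
      have hsq := tangentLength_sq hν (hν1.trans h1.le)
      have hd2 := ((hd.pow 2).sub_const (ν ^ 2)).sqrt (by
        simp only [Pi.pow_apply]
        rw [← h2, ← hsq]; positivity)
      refine HasDerivAt.hasDerivWithinAt ((hd2.add ((hasDerivAt_id t).const_mul ν)).congr_deriv ?_)
      simp only [Pi.pow_apply]
      rw [← h2, ← tangentLength, hc]
      simp only [max_eq_left h1.le]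
      have : 0 < radius ν s α t := by linarith
      field_simp
      norm_num
      right
      ring
  have hR1 := forall_Icc_of_forall_Ico (p := fun t => 1 ≤ radius ν s α t)
    (isClosed_le continuous_const hRc) (by simpa using hs.le) fun t ht => (hR t ht).le
  intro t ht
  have h1 := hR1 t ht
  have h2 := hq t ht
  constructor
  · rw [arrivalTime, le_div_iff₀ hν]
    have := tangentLength_mono (ν := ν) zero_le_one h1
    linarith
  · rw [tangentRadius, ← h2, tangentLength_sq hν (hν1.trans h1), add_sub_cancel,
      sqrt_sq (by linarith)]

/-- The open-loop tangential attack whose side at time `t` is given by the sign `σ t`. -/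
noncomputable def tangentAttack (ν R : ℝ) (σ : ℝ → ℝ) : ℝ → ℝ :=
  (Ico 0 (arrivalTime ν R)).indicator fun t => σ t * arcsin (ν / tangentRadius ν R t)

lemma approachControl_tangentAttack {R : ℝ} (hν : 0 < ν) (hν1 : ν ≤ 1) (hσm : Measurable σ)
    (hσ : ∀ t, σ t = 1 ∨ σ t = -1) : ApproachControl (tangentAttack ν R σ) := by
  constructor
  · exact (hσm.mul (measurable_arcsin.comp (measurable_const.div
      (continuous_tangentRadius ν R).measurable))).indicator measurableSet_Ico
  · intro t
    rw [mem_Ioo, ← _root_.abs_lt, tangentAttack]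
    by_cases ht : t ∈ Ico 0 (arrivalTime ν R)
    -- Excluding the arrival time matters: for `ν = 1` the heading there would be `π / 2`, outside
    -- the open range of approach controls.
    · have h1 := one_lt_tangentRadius hν hν1 ht.2
      have h2 : ν / tangentRadius ν R t < 1 := (div_lt_one (by linarith)).2 (by linarith)
      rw [indicator_of_mem ht, abs_mul_sign (hσ t), abs_of_nonneg (arcsin_nonneg.2 (by positivity)),
        arcsin_lt_pi_div_two]
      exact h2
    · rw [indicator_of_notMem ht, abs_zero]
      positivity

lemma tangentAttack_eq (ν R : ℝ) (σ : ℝ → ℝ) : ∀ᵐ t : ℝ, t ∈ Ico 0 (arrivalTime ν R) →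
    tangentAttack ν R σ t = σ t * arcsin (ν / tangentRadius ν R t) :=
  Filter.Eventually.of_forall fun _ ht => indicator_of_mem ht _

end CircularDefense

namespace CircularDefense

variable {ν : ℝ} {s : State} {α u : ℝ → ℝ} {T σ : ℝ}

/-! ### The attacker's feedback -/

lemma mul_mem_Ioo_of_abs_le (h0 : s.θ ≠ 0) (hπ : |s.θ| ≤ π) (hσθ : σ * s.θ = |s.θ|) :
    σ * s.θ ∈ Ioo 0 (2 * π) :=
  ⟨hσθ ▸ abs_pos.2 h0, by linarith [pi_pos]⟩

/-- Under `α*` the separation in excess of the surface does not decrease, whereas a defender running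
the other way round gains too little. -/
lemma tangent_bounds (hν : 0 < ν) (hν1 : ν ≤ 1) (hα : Measurable α) (hu : DefenderControl u)
    (hs : 1 < s.R) (hσ : σ = 1 ∨ σ = -1) (hR : ∀ t ∈ Ico 0 T, 1 < radius ν s α t)
    (h : ∀ᵐ t : ℝ, t ∈ Ico 0 T → α t = σ * arcsin (ν / radius ν s α t)) :
    ∀ t ∈ Icc 0 T, t ≤ arrivalTime ν s.R ∧ 1 ≤ radius ν s α t ∧ radius ν s α t ≤ s.R ∧
      σ * s.θ - thetaG ν s.R ≤ σ * angle ν s α u t - thetaG ν (radius ν s α t) ∧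
      σ * angle ν s α u t + thetaG ν (radius ν s α t) < σ * s.θ + thetaG ν s.R + π := by
  intro t ht
  have hrad := radius_eq_tangentRadius_of_feedback (σ := fun _ => σ) hν hν1 hα hs (fun _ => hσ) hR h
  have hang := angle_eq_of_tangent (u := u) (σ := fun _ => σ) (T := T) hν (fun _ => hσ) (by
    filter_upwards [h] with x hx hxT
    rw [hx hxT, (hrad x ⟨hxT.1, hxT.2.le⟩).2]) (fun x hx => (hrad x hx).2) t ht
  obtain ⟨htA, hrt⟩ := hrad t ht
  have hG := thetaG_sub_thetaG_tangentRadius hν hν1 hs.le htA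
  have hsw := sweptAngle_lt hν htA
  rw [intervalIntegral.integral_sub
    (((continuous_sweptRate hν s.R).const_mul _).intervalIntegrable _ _)
    (hu.intervalIntegrable _ _), intervalIntegral.integral_const_mul, integral_sweptRate hν,
    sweptAngle_zero, sub_zero] at hang
  have hσ2 : σ * σ = 1 := by rcases hσ with rfl | rfl <;> norm_num
  have hmul : σ * angle ν s α u t =
      σ * s.θ + sweptAngle ν s.R t - σ * ∫ x in (0 : ℝ)..t, u x := by
    rw [hang]
    linear_combination sweptAngle ν s.R t * hσ2
  have hint : |σ * ∫ x in (0 : ℝ)..t, u x| ≤ t := by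
    rw [abs_mul_sign hσ]
    have := intervalIntegral.norm_integral_le_of_norm_le_const (a := 0) (b := t) (C := 1) (f := u)
      fun x _ => hu.abs_le x
    rwa [Real.norm_eq_abs, one_mul, sub_zero, abs_of_nonneg ht.1] at this
  obtain ⟨h1, h2⟩ := _root_.abs_le.1 hint
  rw [hrt]
  -- The defender contributes between `-t` and `t`. The surface identity turns the lower bound into
  -- monotonicity of the excess and leaves twice the swept angle, less than `π`, in the upper one.
  exact ⟨htA, one_le_tangentRadius hν hν1 htA, tangentRadius_le hν (hν1.trans hs.le) ht.1 htA,
    by linarith, by linarith⟩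

lemma ae_eq_of_steers (hα : Measurable α) (hu : DefenderControl u)
    (hs : 1 < s.R) (hσ : σ = 1 ∨ σ = -1) (h0 : σ * s.θ ∈ Ioo 0 (2 * π))
    (hrun : RunningBefore ν s α u T)
    (h : ∀ᵐ t : ℝ, t ∈ Ico 0 T → α t = alphaStar ν (stateAt ν s α u t)) :
    ∀ᵐ t : ℝ, t ∈ Ico 0 T → α t = σ * arcsin (ν / radius ν s α t) := by
  filter_upwards [h, ae_sign_angle_eq (ν := ν) hα hu hs hσ h0] with t h1 h2 ht
  rw [h1 ht]
  change Real.sign (angle ν s α u t) * _ = _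
  rw [(h2 ht.1 (hrun.mono ht.2.le)).2]
  rfl

lemma AttackerSteers.bounds (hst : AttackerSteers ν s α u) (hν : 0 < ν) (hν1 : ν ≤ 1)
    (hα : Measurable α) (hu : DefenderControl u) (hs : 1 < s.R) (hσ : σ = 1 ∨ σ = -1)
    (h0 : σ * s.θ ∈ Ioo 0 (2 * π)) (hrun : RunningBefore ν s α u T) :
    ∀ t ∈ Icc 0 T, t ≤ arrivalTime ν s.R ∧ 1 ≤ radius ν s α t ∧ radius ν s α t ≤ s.R ∧
      σ * s.θ - thetaG ν s.R ≤ σ * angle ν s α u t - thetaG ν (radius ν s α t) ∧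
      σ * angle ν s α u t + thetaG ν (radius ν s α t) < σ * s.θ + thetaG ν s.R + π := by
  refine tangent_bounds hν hν1 hα hu hs hσ (fun t ht => (hrun t ht).1)
    (ae_eq_of_steers hα hu hs hσ h0 hrun ?_)
  filter_upwards [hst] with t h ht
  exact h ht.1 (hrun.mono ht.2.le)

lemma AttackerSteers.ends (hst : AttackerSteers ν s α u) (hν : 0 < ν) (hν1 : ν ≤ 1)
    (hα : Measurable α) (hu : DefenderControl u) (hs : 1 < s.R) (hσ : σ = 1 ∨ σ = -1)
    (h0 : σ * s.θ ∈ Ioo 0 (2 * π)) :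
    ∃ T, 0 ≤ T ∧ RunningBefore ν s α u T ∧
      1 ≤ radius ν s α T ∧ (radius ν s α T = 1 ∨ (stateAt ν s α u T).Aligned) := by
  rcases running_or_ends (ν := ν) hα hu hs with h | h
  · have hA := arrivalTime_pos hν hν1 hs
    have := (hst.bounds hν hν1 hα hu hs hσ h0 (h (arrivalTime ν s.R + 1))
      (arrivalTime ν s.R + 1) ⟨by linarith, le_rfl⟩).1
    linarith
  · exact h

/-- One open-loop heading serves against all defender controls: the side is constant during play,
and the radius does not depend on `u`. -/
lemma exists_attackerSteers (hν : 0 < ν) (hν1 : ν ≤ 1) (hs : 1 < s.R) (hπ : |s.θ| ≤ π) :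
    ∃ α, ApproachControl α ∧ ∀ u, DefenderControl u → AttackerSteers ν s α u := by
  rcases eq_or_ne s.θ 0 with h0 | h0
  · refine ⟨fun _ => 0, ⟨measurable_const, fun _ => ⟨by linarith [pi_pos], by positivity⟩⟩,
      fun u _ => ?_⟩
    filter_upwards [compl_mem_ae_iff.2 (measure_singleton (0 : ℝ))] with t ht0 ht hrun
    refine absurd ?_ (hrun 0 ⟨le_rfl, lt_of_le_of_ne ht (Ne.symm ht0)⟩).2
    exact State.aligned_of_eq_zero (by simpa [stateAt] using h0)
  obtain ⟨σ, hσ, hσθ⟩ := exists_sign h0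
  have hα := approachControl_tangentAttack (R := s.R) hν hν1 (σ := fun _ => σ) measurable_const
    fun _ => hσ
  refine ⟨_, hα, fun u hu => ?_⟩
  have hrad := radius_eq_tangentRadius hν hν1 hs (fun _ => hσ) le_rfl
    (tangentAttack_eq ν s.R fun _ => σ)
  filter_upwards [tangentAttack_eq ν s.R fun _ => σ, ae_sign_angle_eq (ν := ν) hα.1 hu hs hσ
    (mul_mem_Ioo_of_abs_le h0 hπ hσθ)] with t h1 h2 ht hrun
  obtain ⟨h3, h4⟩ := h2 ht hrun
  have hA := arrivalTime_pos hν hν1 hs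
  have hrA := hrad (arrivalTime ν s.R) ⟨hA.le, le_rfl⟩
  rw [tangentRadius_arrivalTime hν hν1] at hrA
  have htA : t < arrivalTime ν s.R := by
    by_contra! hge
    rcases hge.eq_or_lt with h | h
    · rw [← h, hrA] at h3
      exact lt_irrefl _ h3
    · have : 1 < radius ν s _ (arrivalTime ν s.R) := (hrun _ ⟨hA.le, h⟩).1
      rw [hrA] at this
      exact lt_irrefl _ this
  rw [h1 ⟨ht, htA⟩]
  change _ = Real.sign (angle ν s _ u t) * arcsin (ν / radius ν s _ t)
  rw [h4, hrad t ⟨ht, htA.le⟩]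

/-- From a state above the surface, `α*` and `u*` lead to the target along the level. -/
lemma AttackerSteers.penetration_level (hst : AttackerSteers ν s α u)
    (hfol : DefenderFollows ν s α u) (hν : 0 < ν) (hν1 : ν ≤ 1) (hα : Measurable α)
    (hu : DefenderControl u) (hs : 1 < s.R) (hπ : |s.θ| ≤ π) (hG : thetaG ν s.R ≤ |s.θ|) :
    ∃ T, 0 ≤ T ∧ RunningBefore ν s α u T ∧ radius ν s α T = 1 ∧
      |angle ν s α u T| = |s.θ| - thetaG ν s.R ∧
      ∀ t ∈ Icc 0 T, 1 ≤ radius ν s α t ∧ radius ν s α t ≤ s.R ∧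
        thetaG ν (radius ν s α t) ≤ |angle ν s α u t| ∧ |angle ν s α u t| ≤ |s.θ| := by
  have h0 : s.θ ≠ 0 := fun h => by
    rw [h, abs_zero] at hG
    exact absurd (thetaG_pos hν hν1 hs) (not_lt.2 hG)
  obtain ⟨σ, hσ, hσθ⟩ := exists_sign h0
  have h0' := mul_mem_Ioo_of_abs_le h0 hπ hσθ
  obtain ⟨T, hT, hrun, hR, hend⟩ := hst.ends hν hν1 hα hu hs hσ h0'
  have hb := hst.bounds hν hν1 hα hu hs hσ h0' hrun
  have hle := fun t ht => hfol.abs_angle_le hν hν1 hα hu hs hπ hrun (t := t) ht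
  have hσa : ∀ t ∈ Icc 0 T, σ * angle ν s α u t = |angle ν s α u t| := fun t ht => by
    rw [← abs_mul_sign hσ, abs_of_nonneg (hrun.mul_angle_mem_Icc hα hu hs hσ h0' t ht).1]
  have hTT : T ∈ Icc 0 T := ⟨hT, le_rfl⟩
  have hG' : ∀ t ∈ Icc 0 T, thetaG ν (radius ν s α t) ≤ |angle ν s α u t| := fun t ht => by
    have := (hb t ht).2.2.2.1
    rw [hσa t ht, hσθ] at this
    linarith
  have hR1 : radius ν s α T = 1 := by
    rcases hend with h | h
    · exact h
    -- Angle zero on or above the surface is possible only at `R = 1`; `2 * π` is excluded because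
    -- `|θ|` does not increase under `u*`.
    · have h1 : (σ * angle ν s α u T : ℝ) = 0 ∨ σ * angle ν s α u T = 2 * π :=
        eq_zero_or_of_coe_eq_zero (hrun.mul_angle_mem_Icc hα hu hs hσ h0' T hTT)
          ((coe_eq_zero_of_mul hσ).2 h)
      rw [hσa T hTT] at h1
      rcases h1 with h1 | h1
      · by_contra hne
        have := thetaG_pos hν hν1 (lt_of_le_of_ne hR (Ne.symm hne))
        linarith [hG' T hTT]
      · linarith [(hle T hTT).1, pi_pos]
  refine ⟨T, hT, hrun, hR1, ?_, fun t ht => ⟨(hb t ht).2.1, (hb t ht).2.2.1, hG' t ht, (hle t ht).1⟩⟩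
  have h1 := (hb T hTT).2.2.2.1
  have h2 := (hle T hTT).2
  rw [hσa T hTT, hσθ] at h1
  rw [hR1, thetaG_one] at h1 h2
  linarith

/-- Below the surface `α*` brings the play to an end within the level of the surface. -/
lemma AttackerSteers.exists_end_le (hst : AttackerSteers ν s α u) (hν : 0 < ν) (hν1 : ν ≤ 1)
    (hα : Measurable α) (hu : DefenderControl u) (hs : 1 < s.R) (hπ : |s.θ| ≤ π / 2)
    (hG : |s.θ| ≤ thetaG ν s.R) :
    ∃ T, (PenetratesAt ν s α u T ∨ InterceptsAt ν s α u T) ∧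
      thetaG ν (radius ν s α T) ≤ thetaG ν s.R - |s.θ| ∧ 1 ≤ radius ν s α T := by
  rcases eq_or_ne s.θ 0 with h0 | h0
  · refine ⟨0, Or.inr ⟨le_rfl, fun t ht => absurd ht.2 (not_lt.2 ht.1), ?_, ?_⟩, ?_, ?_⟩
    · simpa [stateAt] using hs.le
    · exact State.aligned_of_eq_zero (by simpa [stateAt] using h0)
    · simp [h0]
    · simpa using hs.le
  obtain ⟨σ, hσ, hσθ⟩ := exists_sign h0
  have h0' := mul_mem_Ioo_of_abs_le h0 (hπ.trans (by linarith [pi_pos])) hσθ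
  obtain ⟨T, hT, hrun, hR, hend⟩ := hst.ends hν hν1 hα hu hs hσ h0'
  have hTT : T ∈ Icc 0 T := ⟨hT, le_rfl⟩
  have hb := hst.bounds hν hν1 hα hu hs hσ h0' hrun T hTT
  rw [hσθ] at hb
  by_cases hal : (stateAt ν s α u T).Aligned
  · refine ⟨T, Or.inr ⟨hT, hrun, hR, hal⟩, ?_, hR⟩
    -- Alignment after a turn the long way round is not excluded, but then the upper bound together
    -- with `2 * |s.θ| ≤ π` puts the end within the same level.
    rcases eq_zero_or_of_coe_eq_zero (hrun.mul_angle_mem_Icc hα hu hs hσ h0' T hTT)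
      ((coe_eq_zero_of_mul hσ).2 hal) with h1 | h1
    · linarith [hb.2.2.2.1]
    · linarith [hb.2.2.2.2]
  · have hR1 := hend.resolve_right hal
    refine ⟨T, Or.inl ⟨hT, hrun, hR1, hal⟩, ?_, hR⟩
    rw [hR1, thetaG_one]
    linarith

/-! ### The attacker's half of the saddle point -/

lemma separation_of_mem_Icc (hσ : σ = 1 ∨ σ = -1) (h : σ * s.θ ∈ Icc 0 (2 * π)) :
    s.separation = min (σ * s.θ) (2 * π - σ * s.θ) := by
  have hsep : s.separation = |((σ * s.θ : ℝ) : Real.Angle).toReal| := by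
    rw [State.separation]
    rcases hσ with rfl | rfl
    · rw [one_mul]
    · rw [neg_one_mul, Real.Angle.coe_neg, Real.Angle.abs_toReal_neg]
  rw [hsep]
  set x := σ * s.θ
  rcases le_total x π with hx | hx
  · rw [min_eq_left (by linarith)]
    exact Real.Angle.abs_toReal_coe_eq_self_iff.2 ⟨h.1, hx⟩
  · rw [min_eq_right (by linarith), ← Real.Angle.abs_toReal_neg]
    have : (-(x : Real.Angle)) = ((2 * π - x : ℝ) : Real.Angle) := by
      rw [Real.Angle.coe_sub, Real.Angle.coe_two_pi, zero_sub]
    rw [this]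
    exact Real.Angle.abs_toReal_coe_eq_self_iff.2 ⟨by linarith [h.2], by linarith⟩

lemma attackerStrategy_of_le (h : thetaG ν s.R ≤ |s.θ|) :
    attackerStrategy ν s = some (alphaStar ν s) := by
  rw [attackerStrategy, if_pos h]

lemma attackerStrategy_of_lt (h : |s.θ| < thetaG ν s.R) : attackerStrategy ν s = none := by
  rw [attackerStrategy, if_neg (not_le.2 h)]

lemma runningBefore_zero (ν : ℝ) (s : State) (α u : ℝ → ℝ) : RunningBefore ν s α u 0 :=
  fun _ ht => absurd ht.2 (not_lt.2 ht.1)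

lemma attackerSecures_of_lt {ℓ : ℝ → ℝ} (hG : |s.θ| < thetaG ν s.R) :
    AttackerSecures ν ℓ s (max (|s.θ| - thetaG ν s.R) 0) := by
  intro u hu
  have hnone : ∀ α, attackerStrategy ν (stateAt ν s α u 0) = none := fun α =>
    attackerStrategy_of_lt (by simpa [stateAt] using hG)
  constructor
  · refine ⟨fun _ => 0, 0, ⟨measurable_const, fun _ => ⟨by linarith [pi_pos], by positivity⟩⟩,
      le_rfl, Filter.Eventually.of_forall fun t h1 h2 => ?_, fun t h1 h2 _ => ?_⟩
    · exact absurd (EReal.coe_lt_coe_iff.1 (show (t : EReal) < ((0 : ℝ) : EReal) from h2))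
        (not_lt.2 h1)
    · have : t = 0 :=
        le_antisymm (EReal.coe_le_coe_iff.1 (show (t : EReal) ≤ ((0 : ℝ) : EReal) from h2)) h1
      subst this
      simp [hnone]
  · intro α τ _ hτ hfol
    have h0 : τ = ((0 : ℝ) : EReal) :=
      (hfol.2 0 le_rfl (by exact_mod_cast hτ) (runningBefore_zero ν s α u)).2 (hnone α)
    refine ⟨.withdrawal, ⟨0, le_rfl, h0, runningBefore_zero ν s α u⟩, ?_⟩
    exact max_le (sub_nonpos.2 hG.le) le_rfl

/-- The excess never decreases under the rule, so the rule never asks to stop and play runs to its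
end. Interception can occur only at `R = 1`, with initial excess zero; there the loss vanishes. -/
lemma attackerSecures_of_le {ℓ : ℝ → ℝ} (hℓ : ℓ 1 = 0) (hν : 0 < ν) (hν1 : ν ≤ 1) (hs : 1 < s.R)
    (hπ : |s.θ| ≤ π / 2) (hG : thetaG ν s.R ≤ |s.θ|) :
    AttackerSecures ν ℓ s (max (|s.θ| - thetaG ν s.R) 0) := by
  have h0 : s.θ ≠ 0 := fun h => by
    rw [h, abs_zero] at hG
    exact absurd (thetaG_pos hν hν1 hs) (not_lt.2 hG)
  have hπ' : |s.θ| ≤ π := hπ.trans (by linarith [pi_pos])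
  obtain ⟨σ, hσ, hσθ⟩ := exists_sign h0
  have h0' := mul_mem_Ioo_of_abs_le h0 hπ' hσθ
  have habove : ∀ {α u : ℝ → ℝ} {t : ℝ}, σ * s.θ - thetaG ν s.R ≤
      σ * angle ν s α u t - thetaG ν (radius ν s α t) →
      thetaG ν (stateAt ν s α u t).R ≤ |(stateAt ν s α u t).θ| := by
    intro α u t h
    have h1 := le_abs_self (σ * angle ν s α u t)
    rw [abs_mul_sign hσ] at h1
    change thetaG ν (radius ν s α t) ≤ |angle ν s α u t|
    linarith
  intro u hu
  constructor
  · obtain ⟨α, hα, hst⟩ := exists_attackerSteers hν hν1 hs hπ'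
    refine ⟨α, ⊤, hα, le_top, ?_, fun t ht _ hrun => ?_⟩
    · filter_upwards [hst u hu] with t h ht _ hrun
      rw [h ht hrun]
      exact attackerStrategy_of_le (habove
        ((hst u hu).bounds hν hν1 hα.1 hu hs hσ h0' hrun t ⟨ht, le_rfl⟩).2.2.2.1)
    · rw [attackerStrategy_of_le (habove
        ((hst u hu).bounds hν hν1 hα.1 hu hs hσ h0' hrun t ⟨ht, le_rfl⟩).2.2.2.1)]
      simp
  · intro α τ hα hτ hfol
    have hb : ∀ T : ℝ, (T : EReal) ≤ τ → RunningBefore ν s α u T → ∀ t ∈ Icc 0 T, _ :=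
      fun T hTτ hrun => tangent_bounds hν hν1 hα.1 hu hs hσ (fun t ht => (hrun t ht).1)
        (ae_eq_of_steers hα.1 hu hs hσ h0' hrun (by
          filter_upwards [hfol.1] with t h ht
          have h1 := h ht.1 ((EReal.coe_lt_coe_iff.2 ht.2).trans_le hTτ) (hrun.mono ht.2.le)
          rw [attackerStrategy] at h1
          split_ifs at h1
          exact (Option.some.inj h1).symm))
    have hnot : ∀ t : ℝ, 0 ≤ t → τ = t → ¬ RunningBefore ν s α u t := fun t ht hτt hrun => by
      have h1 := (hfol.2 t ht hτt.ge hrun).1 hτt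
      rw [attackerStrategy_of_le (habove (hb t hτt.ge hrun t ⟨ht, le_rfl⟩).2.2.2.1)] at h1
      exact absurd h1 (by simp)
    have hτr : τ ≠ ⊤ → ∃ t : ℝ, 0 ≤ t ∧ τ = t := fun h => by
      lift τ to ℝ using ⟨h, fun h' => by simp [h'] at hτ⟩
      exact ⟨τ, by exact_mod_cast hτ, rfl⟩
    rcases running_or_ends (ν := ν) hα.1 hu hs with h | ⟨T, hT, hrun, hR, hend⟩
    · rcases eq_or_ne τ ⊤ with h' | h'
      · have hA := arrivalTime_pos hν hν1 hs
        have := (hb (arrivalTime ν s.R + 1) (by rw [h']; exact le_top) (h _)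
          (arrivalTime ν s.R + 1) ⟨by linarith, le_rfl⟩).1
        linarith
      · obtain ⟨t, ht, rfl⟩ := hτr h'
        exact absurd (h t) (hnot t ht rfl)
    have hTτ : (T : EReal) < τ := by
      by_contra! hle
      obtain ⟨t, ht, rfl⟩ := hτr (ne_top_of_le_ne_top (EReal.coe_ne_top T) hle)
      exact hnot t ht rfl (hrun.mono (by exact_mod_cast hle))
    have hTT : T ∈ Icc 0 T := ⟨hT, le_rfl⟩
    obtain ⟨-, -, -, hlow, hup⟩ := hb T hTτ.le hrun T hTT
    rw [hσθ] at hlow hup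
    have hmem := hrun.mul_angle_mem_Icc hα.1 hu hs hσ h0' T hTT
    have hGT := thetaG_nonneg hν hν1 hR
    by_cases hal : (stateAt ν s α u T).Aligned
    · have hz : σ * angle ν s α u T = 0 := by
        refine (eq_zero_or_of_coe_eq_zero hmem ((coe_eq_zero_of_mul hσ).2 hal)).resolve_right ?_
        intro h1
        linarith
      have hR1 : radius ν s α T = 1 := by
        by_contra hne
        have := thetaG_pos hν hν1 (lt_of_le_of_ne hR (Ne.symm hne))
        linarith
      refine ⟨.interception (radius ν s α T), ⟨T, hTτ, ⟨hT, hrun, hR, hal⟩, rfl⟩, ?_⟩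
      rw [payoff, hR1, hℓ, neg_zero]
      exact max_le (by linarith) le_rfl
    · have hR1 := hend.resolve_right hal
      refine ⟨.penetration _, ⟨T, hTτ, ⟨hT, hrun, hR1, hal⟩, rfl⟩, ?_⟩
      rw [payoff, separation_of_mem_Icc (s := stateAt ν s α u T) hσ hmem,
        max_eq_left (by linarith), le_min_iff]
      rw [hR1, thetaG_one] at hlow hup
      change _ ≤ σ * angle ν s α u T ∧ _ ≤ 2 * π - σ * angle ν s α u T
      -- The short way round is bounded by the excess; the long way round by the bound on the total
      -- turn together with `2 * |s.θ| ≤ π`.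
      exact ⟨by linarith, by linarith⟩

end CircularDefense

namespace CircularDefense

variable {ν : ℝ} {s : State} {α u : ℝ → ℝ}

/-! ### Penetration from outside the surface: attacks with a sampled side -/

/-- The side on which an attacker at separation angle `θ` is nearer to the defender. -/
noncomputable def side (θ : ℝ) : ℝ := if 0 ≤ (θ : Real.Angle).toReal then 1 else -1

lemma side_eq (θ : ℝ) : side θ = 1 ∨ side θ = -1 := by
  unfold side; split_ifs <;> simp

lemma side_mul_toReal (θ : ℝ) :
    side θ * (θ : Real.Angle).toReal = |(θ : Real.Angle).toReal| := by
  unfold side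
  split_ifs with h
  · rw [one_mul, abs_of_nonneg h]
  · rw [abs_of_neg (not_le.1 h)]; ring

/-- The separation angles at the sampling times `k * δ` when the attacker gains the angular
speed `ω` on the side chosen at the last sampling time. -/
noncomputable def sampledAngle (ω u : ℝ → ℝ) (θ δ : ℝ) : ℕ → ℝ
  | 0 => θ
  | k + 1 => sampledAngle ω u θ δ k +
      ∫ x in (k * δ)..((k + 1) * δ), (side (sampledAngle ω u θ δ k) * ω x - u x)

/-- The side at time `t`, as chosen at the last sampling time. -/
noncomputable def sampledSide (ω u : ℝ → ℝ) (θ δ t : ℝ) : ℝ :=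
  side (sampledAngle ω u θ δ ⌊t / δ⌋₊)

lemma sampledSide_eq (ω u : ℝ → ℝ) (θ δ t : ℝ) :
    sampledSide ω u θ δ t = 1 ∨ sampledSide ω u θ δ t = -1 := side_eq _

lemma measurable_sampledSide (ω u : ℝ → ℝ) (θ δ : ℝ) : Measurable (sampledSide ω u θ δ) :=
  (measurable_from_top (f := fun k : ℕ => side (sampledAngle ω u θ δ k))).comp
    (Nat.measurable_floor.comp (measurable_id.div_const δ))

lemma sampledAngle_congr {ω u v : ℝ → ℝ} {θ δ t : ℝ} (hδ : 0 < δ)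
    (h : ∀ᵐ x : ℝ, x ∈ Icc 0 t → u x = v x) (k : ℕ) (hk : k * δ ≤ t) :
    sampledAngle ω u θ δ k = sampledAngle ω v θ δ k := by
  induction k with
  | zero => rfl
  | succ k ih =>
    push_cast at hk
    have hk' : k * δ ≤ t := by nlinarith
    rw [sampledAngle, sampledAngle, ih hk']
    congr 1
    refine intervalIntegral.integral_congr_ae ?_
    filter_upwards [h] with x hx hxk
    rw [uIoc_of_le (by nlinarith)] at hxk
    have : 0 ≤ k * δ := by positivity
    rw [hx ⟨by linarith [hxk.1], hxk.2.trans hk⟩]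

/-- The side in use at time `x` depends on the defender's control only up to the last sampling time,
which is at most `x`. Sampling also avoids a feedback that is discontinuous at the antipode. -/
lemma nonanticipative_sampled (ν R : ℝ) (ω : ℝ → ℝ) (θ : ℝ) {δ : ℝ} (hδ : 0 < δ) :
    Nonanticipative fun u => tangentAttack ν R (sampledSide ω u θ δ) := by
  intro u v _ _ t h
  refine Filter.Eventually.of_forall fun x hx => ?_
  have hfl : (⌊x / δ⌋₊ : ℝ) * δ ≤ t := by
    rw [← le_div_iff₀ hδ]
    exact (Nat.floor_le (div_nonneg hx.1 hδ.le)).trans (by gcongr; exact hx.2)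
  have hside : sampledSide ω u θ δ x = sampledSide ω v θ δ x := by
    rw [sampledSide, sampledSide, sampledAngle_congr hδ h _ hfl]
  by_cases hxA : x ∈ Ico 0 (arrivalTime ν R)
  · simp only [tangentAttack, indicator_of_mem hxA, hside]
  · simp only [tangentAttack, indicator_of_notMem hxA]

lemma integral_sampled {ω : ℝ → ℝ} {θ δ : ℝ} (hδ : 0 < δ) (hω : Continuous ω)
    (hu : DefenderControl u) (k : ℕ) {t : ℝ} (ht : t ∈ Icc (k * δ) ((k + 1) * δ)) :
    θ + ∫ x in (0 : ℝ)..t, (sampledSide ω u θ δ x * ω x - u x) = sampledAngle ω u θ δ k +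
      ∫ x in (k * δ)..t, (side (sampledAngle ω u θ δ k) * ω x - u x) := by
  have hint : ∀ a b, IntervalIntegrable (fun x => sampledSide ω u θ δ x * ω x - u x)
      volume a b := by
    intro a b
    refine IntervalIntegrable.sub ?_ (hu.intervalIntegrable a b)
    refine (hω.intervalIntegrable a b).mono_fun
      (((measurable_sampledSide ω u θ δ).mul hω.measurable).aestronglyMeasurable)
      (Filter.Eventually.of_forall fun x => ?_)
    simp only [Real.norm_eq_abs]
    exact (abs_mul_sign (sampledSide_eq ω u θ δ x) (ω x)).le
  have hstep : ∀ (k : ℕ) (t : ℝ), t ∈ Icc (k * δ) ((k + 1) * δ) →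
      ∫ x in (k * δ)..t, (sampledSide ω u θ δ x * ω x - u x) =
        ∫ x in (k * δ)..t, (side (sampledAngle ω u θ δ k) * ω x - u x) := by
    intro k t ht
    refine intervalIntegral.integral_congr_ae ?_
    filter_upwards [compl_mem_ae_iff.2 (measure_singleton ((k + 1) * δ))] with x hxne hx
    rw [uIoc_of_le ht.1] at hx
    have hx2 : x < (k + 1) * δ := lt_of_le_of_ne (hx.2.trans ht.2) hxne
    have hfl : ⌊x / δ⌋₊ = k := by
      rw [Nat.floor_eq_iff (div_nonneg ((by positivity : 0 ≤ k * δ).trans hx.1.le) hδ.le)]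
      exact ⟨(le_div_iff₀ hδ).2 hx.1.le, (div_lt_iff₀ hδ).2 hx2⟩
    rw [sampledSide, hfl]
  have hgrid : ∀ k : ℕ, θ + ∫ x in (0 : ℝ)..(k * δ), (sampledSide ω u θ δ x * ω x - u x) =
      sampledAngle ω u θ δ k := by
    intro k
    induction k with
    | zero => simp [sampledAngle]
    | succ k ih =>
      rw [sampledAngle, ← hstep k _ ⟨by nlinarith, le_rfl⟩, ← ih, add_assoc,
        intervalIntegral.integral_add_adjacent_intervals (hint _ _) (hint _ _)]
      push_cast
      rfl
  rw [← hstep k t ht, ← hgrid k, add_assoc,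
    intervalIntegral.integral_add_adjacent_intervals (hint _ _) (hint _ _)]

/-- With the side sampled, the separation exceeds the surface by a fixed amount. -/
lemma le_separation_sampled {R θ m δ : ℝ} (hν : 0 < ν) (hν1 : ν ≤ 1) (hR : 1 < R) (hδ : 0 < δ)
    (hm : 2 * δ < m) (hθ : |θ| = thetaG ν R + m) (hπ : |θ| ≤ π) (hu : DefenderControl u) {t : ℝ}
    (ht : t ∈ Icc 0 (arrivalTime ν R)) :
    thetaG ν (tangentRadius ν R t) + (m - 2 * δ) ≤ |((θ + ∫ x in (0 : ℝ)..t,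
      (sampledSide (fun x => ν ^ 2 / tangentRadius ν R x ^ 2) u θ δ x *
        (ν ^ 2 / tangentRadius ν R x ^ 2) - u x) : ℝ) : Real.Angle).toReal| := by
  set ω : ℝ → ℝ := fun x => ν ^ 2 / tangentRadius ν R x ^ 2 with hω
  have hωc : Continuous ω := continuous_sweptRate hν R
  set φ : ℝ → ℝ := fun t => θ + ∫ x in (0 : ℝ)..t, (sampledSide ω u θ δ x * ω x - u x) with hφ
  have hGpos := thetaG_nonneg hν hν1 hR.le
  -- The margin `m - 2 * δ` is itself the invariant, so nothing is lost from one sampling interval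
  -- to the next.
  have key : ∀ (k : ℕ) (t : ℝ), t ∈ Icc (k * δ) ((k + 1) * δ) → t ≤ arrivalTime ν R →
      thetaG ν (tangentRadius ν R (k * δ)) + (m - 2 * δ) ≤ |(φ (k * δ) : Real.Angle).toReal| →
      thetaG ν (tangentRadius ν R t) + (m - 2 * δ) ≤ |(φ t : Real.Angle).toReal| := by
    intro k t ht htA hk
    have hk0 : (0 : ℝ) ≤ k * δ := by positivity
    have hφk : φ (k * δ) = sampledAngle ω u θ δ k := by
      have := integral_sampled (θ := θ) hδ hωc hu k (t := k * δ) ⟨le_rfl, by nlinarith⟩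
      rwa [intervalIntegral.integral_same, add_zero] at this
    have hφt : φ t = _ := integral_sampled (θ := θ) hδ hωc hu k ht
    rw [← hφk, intervalIntegral.integral_sub ((hωc.const_mul _).intervalIntegrable _ _)
      (hu.intervalIntegrable _ _), intervalIntegral.integral_const_mul] at hφt
    set c := side (φ (k * δ)) with hc
    have hcs : c = 1 ∨ c = -1 := side_eq _
    set r := (φ (k * δ) : Real.Angle).toReal with hr
    have hcr : c * r = |r| := side_mul_toReal _
    set J := ∫ x in (k * δ)..t, ω x with hJ
    set U := ∫ x in (k * δ)..t, u x with hU
    have hUle : |c * U| ≤ t - k * δ := by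
      rw [abs_mul_sign hcs]
      have := intervalIntegral.norm_integral_le_of_norm_le_const (a := k * δ) (b := t) (C := 1)
        (f := u) fun x _ => hu.abs_le x
      rwa [Real.norm_eq_abs, one_mul, abs_of_nonneg (sub_nonneg.2 ht.1)] at this
    have hJle : J ≤ t - k * δ := by
      have : J ≤ ∫ _ in (k * δ)..t, (1 : ℝ) := by
        refine intervalIntegral.integral_mono_on ht.1 (hωc.intervalIntegrable _ _)
          (by simp) fun x _ => ?_
        have h1 := le_tangentRadius ν R x
        have h2 := hν.trans_le h1
        exact (div_le_one (by positivity)).2 (by gcongr)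
      simpa using this
    have hJeq : J = sweptAngle ν R t - sweptAngle ν R (k * δ) := integral_sweptRate hν R _ _
    have h1 := thetaG_sub_thetaG_tangentRadius hν hν1 hR.le htA
    have h2 := thetaG_sub_thetaG_tangentRadius hν hν1 hR.le (ht.1.trans htA)
    have h3 : thetaG ν (tangentRadius ν R t) ≤ thetaG ν R :=
      (strictMonoOn_thetaG hν hν1).monotoneOn (one_le_tangentRadius hν hν1 htA) hR.le
        (tangentRadius_le hν (hν1.trans hR.le) (hk0.trans ht.1) htA)
    have h4 := thetaG_nonneg hν hν1 (one_le_tangentRadius hν hν1 htA)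
    have hrπ : |r| ≤ π := Real.Angle.abs_toReal_le_pi _
    obtain ⟨hU1, hU2⟩ := _root_.abs_le.1 hUle
    have hcc : c * c = 1 := by rcases hcs with h | h <;> rw [h] <;> norm_num
    have hp : c * (r + (c * J - U)) = |r| + J - c * U := by
      rw [← hcr]; linear_combination J * hcc
    have hcoe : (φ t : Real.Angle) = ((r + (c * J - U) : ℝ) : Real.Angle) := by
      rw [hφt, Real.Angle.coe_add, Real.Angle.coe_add r, hr, Real.Angle.coe_toReal]
    have ht2 := ht.2
    have hsep := separation_of_mem_Icc (s := ⟨0, r + (c * J - U)⟩) hcs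
      (by rw [hp]; exact ⟨by linarith, by linarith⟩)
    simp only [State.separation, hp] at hsep
    rw [hcoe, hsep, le_min_iff]
    -- On the chosen side the excess does not decrease. Past the antipode the separation is still at
    -- least `π - 2 * δ`, because both players turn by at most `δ`, and `π ≥ thetaG ν R + m`.
    exact ⟨by linarith, by linarith⟩
  have hgrid : ∀ k : ℕ, k * δ ≤ arrivalTime ν R →
      thetaG ν (tangentRadius ν R (k * δ)) + (m - 2 * δ) ≤
        |(φ (k * δ) : Real.Angle).toReal| := by
    intro k
    induction k with
    | zero =>
      intro _
      have hsep := separation_le_abs (s := ⟨0, θ⟩) hπ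
      simp only [State.separation] at hsep
      simp only [hφ, Nat.cast_zero, zero_mul, intervalIntegral.integral_same, add_zero]
      rw [tangentRadius_zero hν (hν1.trans hR.le), hsep, hθ]
      linarith
    | succ k ih =>
      intro hk
      push_cast at hk ⊢
      exact key k _ ⟨by nlinarith, le_rfl⟩ hk (ih (by nlinarith))
  have hfl : (⌊t / δ⌋₊ : ℝ) * δ ≤ t :=
    (le_div_iff₀ hδ).1 (Nat.floor_le (div_nonneg ht.1 hδ.le))
  have hfl2 : t ≤ (⌊t / δ⌋₊ + 1 : ℝ) * δ := ((div_lt_iff₀ hδ).1 (Nat.lt_floor_add_one _)).le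
  exact key _ t ⟨hfl, hfl2⟩ ht.2 (hgrid _ (hfl.trans ht.2))

lemma attackerWins_of_lt (hν : 0 < ν) (hν1 : ν ≤ 1) (hs : 1 < s.R) (hπ : |s.θ| ≤ π)
    (hG : thetaG ν s.R < |s.θ|) : AttackerWins ν s := by
  set m := |s.θ| - thetaG ν s.R with hm
  have hm0 : 0 < m := sub_pos.2 hG
  -- With the sampling step `m / 4` half of the margin survives.
  have hδ : 0 < m / 4 := by positivity
  refine ⟨_, nonanticipative_sampled ν s.R (fun x => ν ^ 2 / tangentRadius ν s.R x ^ 2) s.θ hδ,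
    fun u hu => ?_⟩
  set σ := sampledSide (fun x => ν ^ 2 / tangentRadius ν s.R x ^ 2) u s.θ (m / 4) with hσdef
  have hσ : ∀ t, σ t = 1 ∨ σ t = -1 := sampledSide_eq _ _ _ _
  refine ⟨approachControl_tangentAttack hν hν1 (measurable_sampledSide _ _ _ _) hσ,
    arrivalTime ν s.R, ?_⟩
  have hA := arrivalTime_pos hν hν1 hs
  have hrad := radius_eq_tangentRadius hν hν1 hs hσ le_rfl (tangentAttack_eq ν s.R σ)
  have hang := angle_eq_of_tangent (u := u) hν hσ (tangentAttack_eq ν s.R σ) hrad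
  have hnal : ∀ t ∈ Icc 0 (arrivalTime ν s.R),
      ¬ (stateAt ν s (tangentAttack ν s.R σ) u t).Aligned := by
    intro t ht hal
    have h1 := le_separation_sampled (m := m) hν hν1 hs hδ (by linarith) (by linarith) hπ hu ht
    have h2 := thetaG_nonneg hν hν1 (one_le_tangentRadius (R := s.R) hν hν1 ht.2)
    change (angle ν s (tangentAttack ν s.R σ) u t : Real.Angle) = 0 at hal
    rw [← hσdef, ← hang t ht, hal, Real.Angle.toReal_zero, abs_zero] at h1
    linarith
  refine ⟨hA.le, fun t ht => ⟨?_, hnal t ⟨ht.1, ht.2.le⟩⟩, ?_, hnal _ ⟨hA.le, le_rfl⟩⟩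
  · change 1 < radius ν s _ t
    rw [hrad t ⟨ht.1, ht.2.le⟩]
    exact one_lt_tangentRadius hν hν1 ht.2
  · change radius ν s _ _ = 1
    rw [hrad _ ⟨hA.le, le_rfl⟩, tangentRadius_arrivalTime hν hν1]

/-! ### The regions and the stage -/

lemma ApproachControl.radius_le (hα : ApproachControl α) (hν : 0 < ν) {t : ℝ} (ht : 0 ≤ t) :
    radius ν s α t ≤ s.R := by
  have : 0 ≤ ∫ x in (0 : ℝ)..t, ν * cos (α x) := intervalIntegral.integral_nonneg ht fun x _ =>
    mul_nonneg hν.le (cos_pos_of_mem_Ioo (hα.2 x)).le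
  simp only [radius, neg_mul, intervalIntegral.integral_neg]
  linarith

lemma exists_level {R y : ℝ} (hν : 0 < ν) (hν1 : ν ≤ 1) (hR : 1 ≤ R) (hy : 0 ≤ y)
    (h : y ≤ thetaG ν R) : ∃ ρ ∈ Icc 1 R, thetaG ν ρ = thetaG ν R - y :=
  intermediate_value_Icc hR ((continuousOn_thetaG hν hν1).mono Icc_subset_Ici_self)
    ⟨by rw [thetaG_one]; linarith, by linarith⟩

end CircularDefense

theorem theorem3 (ν rA R₀ : ℝ) (hν : 0 < ν) (hν1 : ν ≤ 1) (hr : 0 < rA)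
    (hr1 : rA ≤ min (R₀ - 1) 1) :
    -- the surface splits the state space into the two winning regions
    (defenderRegion ν R₀ ∪ attackerRegion ν R₀ = stateSpace R₀ ∧
      Disjoint (defenderRegion ν R₀) (attackerRegion ν R₀) ∧
      (∀ s ∈ defenderRegion ν R₀, DefenderWins ν s) ∧
      (∀ s ∈ attackerRegion ν R₀, AttackerWins ν s)) ∧
    -- in the full-information stage:
    (∀ s ∈ fullInfoStage rA,
      -- the attacker's rule (play `α*` if `θ_G ≤ |θ|`, else stop) and `u*` form a saddle point
      (∀ ℓ : ℝ → ℝ, ℓ 1 = 0 → (∀ r, 1 ≤ r → 0 ≤ ℓ r) →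
        AttackerSecures ν ℓ s (max (|s.θ| - thetaG ν s.R) 0) ∧
        DefenderSecures ν ℓ s (max (|s.θ| - thetaG ν s.R) 0)) ∧
      -- under `u*` and any approaching attacker, the stage lasts until the play ends
      (∀ α u, ApproachControl α → DefenderControl u → DefenderFollows ν s α u →
        ∀ T, 0 ≤ T → RunningBefore ν s α u T → ∀ t ∈ Set.Icc 0 T,
          radius ν s α t ≤ 1 + rA ∧ |angle ν s α u t| ≤ thetaP rA (radius ν s α t)) ∧
      -- the play under `α*` and `u*` when `θ_G ≤ |θ|`
      (thetaG ν s.R ≤ |s.θ| →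
        (∃ α u, ApproachControl α ∧ DefenderControl u ∧
          AttackerSteers ν s α u ∧ DefenderFollows ν s α u) ∧
        ∀ α u, AttackerControl α → DefenderControl u →
          AttackerSteers ν s α u → DefenderFollows ν s α u →
          ∃ T, 0 ≤ T ∧ RunningBefore ν s α u T ∧ radius ν s α T = 1 ∧
            |angle ν s α u T| = |s.θ| - thetaG ν s.R ∧
            ∀ t ∈ Set.Icc 0 T, thetaG ν (radius ν s α t) ≤ |angle ν s α u t| ∧
              |angle ν s α u t| ≤ thetaP rA (radius ν s α t)) ∧
      -- the game of terminal distance, if the attacker goes on attacking when `|θ| ≤ θ_G`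
      (|s.θ| ≤ thetaG ν s.R →
        ∃ ρ ∈ Set.Icc 1 s.R, thetaG ν ρ = thetaG ν s.R - |s.θ| ∧
          (∀ α u, AttackerControl α → DefenderControl u → DefenderFollows ν s α u →
            ∃ T, InterceptsAt ν s α u T ∧ ρ ≤ radius ν s α T) ∧
          (∀ u, DefenderControl u →
            (∃ α, ApproachControl α ∧ AttackerSteers ν s α u) ∧
            ∀ α, AttackerControl α → AttackerSteers ν s α u →
              ∃ T, (PenetratesAt ν s α u T ∨ InterceptsAt ν s α u T) ∧
                radius ν s α T ≤ ρ))) := by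
  have hr1' : rA ≤ 1 := hr1.trans (min_le_right _ _)
  refine ⟨⟨?_, ?_, ?_, ?_⟩, ?_⟩
  · ext s
    simp only [defenderRegion, attackerRegion, Set.mem_union, Set.mem_ofPred_eq, ← and_or_left,
      le_or_gt, and_true]
  · exact Set.disjoint_left.2 fun s h1 h2 => not_le.2 h2.2 h1.2
  · rintro s ⟨⟨hs, -, hπ⟩, hG⟩ α hα
    refine ⟨exists_defenderFollows hα.1 hs hπ, fun u hu hfol => ?_⟩
    obtain ⟨T, hT, -⟩ := hfol.exists_interceptsAt hν hν1 hα.1 hu hs hπ hG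
    exact ⟨T, hT⟩
  · rintro s ⟨⟨hs, -, hπ⟩, hG⟩
    exact attackerWins_of_lt hν hν1 hs hπ hG
  · rintro s ⟨hs, hsr, hP⟩
    have hπ2 : |s.θ| ≤ π / 2 := hP.trans (thetaP_lt hr hr1' hs.le).le
    have hπ : |s.θ| ≤ π := hπ2.trans (by linarith [pi_pos])
    refine ⟨fun ℓ hℓ1 hℓ => ⟨?_, defenderSecures hν hν1 hs hπ hℓ⟩, ?_, ?_, ?_⟩
    · rcases lt_or_ge |s.θ| (thetaG ν s.R) with h | h
      · exact attackerSecures_of_lt h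
      · exact attackerSecures_of_le hℓ1 hν hν1 hs hπ2 h
    · intro α u hα hu hfol T hT hrun t ht
      have hle := hα.radius_le (s := s) hν ht.1
      exact ⟨hle.trans hsr, (hfol.abs_angle_le hν hν1 hα.1 hu hs hπ hrun ht).1.trans
        (hP.trans (thetaP_antitone (hrun.one_le_radius hα.1 hs t ht) hle))⟩
    · intro hG
      constructor
      · obtain ⟨α, hα, hst⟩ := exists_attackerSteers hν hν1 hs hπ
        obtain ⟨u, hu, hfol⟩ := exists_defenderFollows (ν := ν) hα.1 hs hπ
        exact ⟨α, u, hα, hu, hst u hu, hfol⟩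
      · intro α u hα hu hst hfol
        obtain ⟨T, hT, hrun, hR, hang, hall⟩ :=
          hst.penetration_level hfol hν hν1 hα.1 hu hs hπ hG
        refine ⟨T, hT, hrun, hR, hang, fun t ht => ?_⟩
        obtain ⟨h1, h2, h3, h4⟩ := hall t ht
        exact ⟨h3, h4.trans (hP.trans (thetaP_antitone h1 h2))⟩
    · intro hG
      obtain ⟨ρ, hρ, hlev⟩ := exists_level hν hν1 hs.le (abs_nonneg s.θ) hG
      have hmono := strictMonoOn_thetaG hν hν1
      refine ⟨ρ, hρ, hlev, ?_, ?_⟩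
      · intro α u hα hu hfol
        obtain ⟨T, hT, h1⟩ := hfol.exists_interceptsAt hν hν1 hα.1 hu hs hπ hG
        exact ⟨T, hT, (hmono.le_iff_le hρ.1 hT.2.2.1).1 (hlev.trans_le h1)⟩
      · intro u hu
        obtain ⟨α, hα, hst⟩ := exists_attackerSteers hν hν1 hs hπ
        refine ⟨⟨α, hα, hst u hu⟩, fun α hα hst => ?_⟩
        obtain ⟨T, hT, h1, h2⟩ := hst.exists_end_le hν hν1 hα.1 hu hs hπ2 hG
        exact ⟨T, hT, (hmono.le_iff_le h2 hρ.1).1 (hlev ▸ h1)⟩
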